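/- Let $n\ge 0$ and let $M$ be a compact (Hausdorff) smooth $n$-manifold with an equiaffine structure $(\nabla,\theta)$: $\nabla$ is a torsion-free affine connection and $\theta$ a nowhere vanishing smooth $n$-form (which orients $M$) with $\nabla\theta=0$. Let $\mathbf R^{n+1}$ carry its flat connection $D$ and a constant nonzero volume form $\omega$. Let $f:(M,\nabla,\theta)\to(\mathbf R^{n+1},D,\omega)$ be an equiaffine immersion, i.e. a smooth immersion with a smooth transversal vector field $\xi:M\to\mathbf R^{n+1}$ such that $$D_X\,df(Y)=df(\nabla_XY)+\alpha(X,Y)\,\xi,\qquad \theta(X_1,\dots,X_n)=\omega(df(X_1),\dots,df(X_n),\xi)$$ for all vector fields, where $\alpha$ is a symmetric bilinear form (the affine fundamental form), determined by $f$ and $\xi$; fix such a $\xi$. *Total absolute curvature.* For $\phi\in\bigwedge^n\mathbf R^{n+1}$ let $\tilde h_\phi(v)=\omega(\phi\wedge v)$. Let $\omega'$ be the volume form on $\bigwedge^n\mathbf R^{n+1}$ that takes the value $(-1)^{(n+1)n/2}$ on $(\widehat{v_1}\wedge v_2\wedge\cdots\wedge v_{n+1},\dots,v_1\wedge\cdots\wedge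 v_n\wedge\widehat{v_{n+1}})$ (hats denote omission) whenever $\omega(v_1,\dots,v_{n+1})=1$. A unit ellipsoid is a set $S=\{\sum_i a_i\zeta_i:\sum_i a_i^2=1\}\subset\bigwedge^n\mathbf R^{n+1}$, where $\omega'(\zeta_1,\dots,\zeta_{n+1})=1$. Put $\tilde\nu(p,t)=t\,df(e_1)\wedge\cdots\wedge df(e_n)$ for $(p,t)\in M\times\mathbf R$ and a frame $e$ of $T_pM$ with $\theta(e_1,\dots,e_n)=1$, and $B=\tilde\nu^{-1}(S)$, a double cover of $M$. On $B$ let $G(p,t)=(-1)^n\det\big[\tilde h_{\tilde\nu(p,t)}(\alpha(e_i,e_j)\,\xi)\big]_{i,j}$ (the Lipschitz–Killing curvature) and let $\omega_B=t\,\theta$, the contraction of $dt\wedge\theta$ with $t\,\partial_t$. (For $n=0$, where a frame with $\theta(e)=1$ need not exist, use $\tilde\nu(p,t)=t/\theta_p$ and $G=1/\theta_p^2$.) Define $$\tau_S(f)=\frac1{\operatorname{vol}(\mathcal S^{n}(1))}\int_B|G|\,|\omega_B| ,$$ where $\mathcal S^n(1)$ is the Euclidean unit $n$-sphere. **Theorem.**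 If $f$ is a convex hypersurface, i.e. $f$ is an embedding whose image is the boundary of a compact convex set with nonempty interior, then $\tau_S(f)=2$ for every unit ellipsoid $S$. -/

import Mathlib

open scoped Manifold ContDiff Topology
open MeasureTheory

noncomputable section

namespace Equiaffine

/-- The coordinate space `R^k`; as an affine space it carries the flat connection, i.e. the
ordinary directional derivative of vector-valued functions. -/
abbrev Rn (k : ℕ) : Type := EuclideanSpace ℝ (Fin k)

/-- `⋀ⁿ R^{n+1}`, the space in which the Gauss map takes its values (codimension one). -/
abbrev Ext (n : ℕ) : Type := ⋀[ℝ]^n (Rn (n + 1))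

/-- Alternating `(n+1)`-forms on `R^{n+1}`; the nonzero ones are the (parallel) volume elements. -/
abbrev VolumeForm (n : ℕ) : Type := Rn (n + 1) [⋀^Fin (n + 1)]→ₗ[ℝ] ℝ

/-! ### Height functions and unit ellipsoids -/

/-- The linear height function associated with `φ ∈ ⋀ⁿ R^{n+1}`, namely
`x ↦ Ω (φ ∧ x)`; see `height_wedge` and `sub_height_smul_mem_span`. -/
def height {n : ℕ} (Ω : VolumeForm n) (φ : Ext n) (x : Rn (n + 1)) : ℝ :=
  (-1) ^ n * exteriorPower.alternatingMapLinearEquiv (Ω.curryLeft x) φ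

theorem height_wedge {n : ℕ} (Ω : VolumeForm n) (v : Fin n → Rn (n + 1)) (x : Rn (n + 1)) :
    height Ω (exteriorPower.ιMulti ℝ n v) x = Ω (Fin.snoc v x) := by
  have h : (Fin.snoc v x : Fin (n + 1) → Rn (n + 1)) =
      (Fin.cons x v : Fin (n + 1) → Rn (n + 1)) ∘ finRotate (n + 1) :=
    Fin.snoc_eq_cons_rotate v x
  rw [h, AlternatingMap.map_perm, sign_finRotate, height,
    exteriorPower.alternatingMapLinearEquiv_apply_ιMulti, AlternatingMap.curryLeft_apply_apply]
  simp [Units.smul_def, Matrix.vecCons]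

/-- If `Ω (v₁, …, vₙ, w) = 1`, then `x - h(x) w` lies in the span of `v₁, …, vₙ`, i.e. `h(x)` is the
coordinate along `w` of `x` in the decomposition `span {v₁, …, vₙ} ⊕ span {w}`. -/
theorem sub_height_smul_mem_span {n : ℕ} (Ω : VolumeForm n) (v : Fin n → Rn (n + 1))
    (w x : Rn (n + 1)) (h : Ω (Fin.snoc v w) = 1) :
    x - height Ω (exteriorPower.ιMulti ℝ n v) x • w ∈ Submodule.span ℝ (Set.range v) := by
  rw [height_wedge]
  have hadd : ∀ y z : Rn (n + 1), ∀ c : ℝ,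
      Ω (Fin.snoc v (y + c • z)) = Ω (Fin.snoc v y) + c * Ω (Fin.snoc v z) := by
    intro y z c
    have hu : ∀ y : Rn (n + 1), (Fin.snoc v y : Fin (n + 1) → Rn (n + 1)) =
        Function.update (Fin.snoc v 0 : Fin (n + 1) → Rn (n + 1)) (Fin.last n) y := by
      exact fun y => (Fin.update_snoc_last (α := fun _ => Rn (n + 1)) ..).symm
    rw [hu, hu y, hu z, AlternatingMap.map_update_add, AlternatingMap.map_update_smul, smul_eq_mul]
  have hli : LinearIndependent ℝ (Fin.snoc v w : Fin (n + 1) → Rn (n + 1)) := by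
    by_contra hd
    rw [AlternatingMap.map_linearDependent Ω _ hd] at h
    exact zero_ne_one h
  have hspan := hli.span_eq_top_of_card_eq_finrank' (by simp)
  have hx : x ∈ Submodule.span ℝ (Set.range (Fin.snoc v w : Fin (n + 1) → Rn (n + 1))) := by
    rw [hspan]; trivial
  rw [Fin.range_snoc, Submodule.mem_span_insert] at hx
  obtain ⟨c, z, hz, rfl⟩ := hx
  have hz0 : Ω (Fin.snoc v z) = 0 := by
    refine AlternatingMap.map_linearDependent Ω _ fun hl => ?_
    exact (linearIndependent_finSnoc.1 hl).2 hz
  have hc : Ω (Fin.snoc v (c • w + z)) = c := by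
    rw [add_comm (c • w) z, hadd, hz0, h]; ring
  rw [hc]
  simpa using hz

/-- `S` is a unit ellipsoid of `⋀ⁿ R^{n+1}`: the unit sphere with respect to a basis `ζ` with
`ω' (ζ) = 1`. Here `ω'` is the volume element of `⋀ⁿ R^{n+1}` whose value at
`(v₁^ ∧ v₂ ∧ ⋯ ∧ vₙ₊₁, …, v₁ ∧ ⋯ ∧ vₙ ∧ vₙ₊₁^)` (hats denote omission) is `(-1)^{(n+1)n/2}`
for all `v` with `Ω (v) = 1`. Since `ζ.det` is the only volume element with value `1` at `ζ`, the
condition `ω' (ζ) = 1` says that `ζ.det` is this `ω'`. -/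
def IsUnitEllipsoid {n : ℕ} (Ω : VolumeForm n) (S : Set (Ext n)) : Prop :=
  ∃ ζ : Module.Basis (Fin (n + 1)) ℝ (Ext n),
    (∀ v : Fin (n + 1) → Rn (n + 1), Ω v = 1 →
      ζ.det (fun i => exteriorPower.ιMulti ℝ n (fun j => v (i.succAbove j))) =
        (-1) ^ ((n + 1) * n / 2)) ∧
    S = {φ | ∃ a : Fin (n + 1) → ℝ, ∑ i, a i ^ 2 = 1 ∧ φ = ∑ i, a i • ζ i}

theorem map_eq_det_smul {n : ℕ} {T W : Type*} [AddCommGroup T] [Module ℝ T] [AddCommGroup W]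
    [Module ℝ W] (b : Module.Basis (Fin n) ℝ T) (g : T [⋀^Fin n]→ₗ[ℝ] W) (e : Fin n → T) :
    g e = b.det e • g b := by
  have : g = (LinearMap.toSpanSingleton ℝ W (g b)).compAlternatingMap b.det := by
    refine Module.Basis.ext_alternating b fun i h => ?_
    let σ : Equiv.Perm (Fin n) := Equiv.ofBijective i (Finite.injective_iff_bijective.1 h)
    change g (b ∘ σ) = (LinearMap.toSpanSingleton ℝ W (g b)).compAlternatingMap b.det (b ∘ σ)
    simp [AlternatingMap.map_perm, Module.Basis.det_self]
  conv_lhs => rw [this]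
  simp

/-! ### Equiaffine structures -/

section Manifold

variable {n : ℕ} {M : Type*} [TopologicalSpace M] [ChartedSpace (Rn n) M]

/-- Smooth vector fields on `M`. -/
def SmoothField (X : ∀ p : M, TangentSpace (𝓡 n) p) [IsManifold (𝓡 n) ∞ M] : Prop :=
  ContMDiff (𝓡 n) (𝓡 n).tangent ∞ (fun p => (⟨p, X p⟩ : TangentBundle (𝓡 n) M))

/-- The frame of `T_p M` given by the coordinate vectors of the preferred chart at `p`. The
quantities below that are computed with it do not depend on the frame. -/
def stdFrame (p : M) (i : Fin n) : TangentSpace (𝓡 n) p :=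
  (EuclideanSpace.basisFun (Fin n) ℝ i : Rn n)

/-- `stdFrame p` as a basis. -/
def stdBasis (p : M) : Module.Basis (Fin n) ℝ (TangentSpace (𝓡 n) p) :=
  (EuclideanSpace.basisFun (Fin n) ℝ).toBasis

theorem coe_stdBasis (p : M) : ⇑(stdBasis (n := n) p) = stdFrame p := by
  ext1 i
  exact congrFun (EuclideanSpace.basisFun (Fin n) ℝ).coe_toBasis i

/-- `(∇, θ)` is an equiaffine structure on `M`: `∇` is a smooth torsion-free affine connection,
`θ` is a smooth nowhere vanishing `n`-form (a volume element), and `∇ θ = 0`. Mathlib writes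
`cov Y p u` for `(∇_u Y)(p)`. -/
structure IsEquiaffineStructure [IsManifold (𝓡 n) ∞ M]
    (cov : CovariantDerivative (𝓡 n) (Rn n) (TangentSpace (𝓡 n) : M → Type _))
    (θ : ∀ p : M, TangentSpace (𝓡 n) p [⋀^Fin n]→ₗ[ℝ] ℝ) : Prop where
  smooth_cov : cov.ContMDiffCovariantDerivative ∞
  torsion_free : cov.torsion = 0
  smooth_vol : ∀ X : Fin n → ∀ p : M, TangentSpace (𝓡 n) p, (∀ i, SmoothField (X i)) →
    ContMDiff (𝓡 n) 𝓘(ℝ, ℝ) ∞ (fun p => θ p (fun i => X i p))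
  vol_ne_zero : ∀ p, θ p ≠ 0
  parallel : ∀ X : Fin n → ∀ p : M, TangentSpace (𝓡 n) p, (∀ i, SmoothField (X i)) →
    ∀ (p : M) (u : TangentSpace (𝓡 n) p),
      mfderiv (𝓡 n) 𝓘(ℝ, ℝ) (fun q => θ q (fun i => X i q)) p u =
        ∑ i, θ p (Function.update (fun j => X j p) i (cov (X i) p u))

/-! ### Equiaffine immersions of codimension one -/

/-- The differential `df_p : T_p M → R^{n+1}`. -/
def dmap (f : M → Rn (n + 1)) (p : M) : TangentSpace (𝓡 n) p →ₗ[ℝ] Rn (n + 1) :=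
  (mfderiv (𝓡 n) 𝓘(ℝ, Rn (n + 1)) f p).toLinearMap

/-- `D_u df(Y)`: the flat derivative, in the direction `u ∈ T_p M`, of the
vector-valued function `df(Y)`. -/
def flatDeriv (f : M → Rn (n + 1)) (Y : ∀ p : M, TangentSpace (𝓡 n) p) (p : M)
    (u : TangentSpace (𝓡 n) p) : Rn (n + 1) :=
  mfderiv (𝓡 n) 𝓘(ℝ, Rn (n + 1)) (fun q => (dmap f q (Y q) : Rn (n + 1))) p u

/-- The coordinate of `w` along `ξ_p` in `R^{n+1} = df(T_p M) ⊕ span {ξ_p}`; see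
`transCoord_eq`. -/
def transCoord (Ω : VolumeForm n) (f ξ : M → Rn (n + 1)) (p : M) (w : Rn (n + 1)) : ℝ :=
  Ω (Fin.snoc (fun i => dmap f p (stdFrame p i)) w) /
    Ω (Fin.snoc (fun i => dmap f p (stdFrame p i)) (ξ p))

theorem transCoord_eq (Ω : VolumeForm n) (f ξ : M → Rn (n + 1)) (p : M)
    (h : Ω (Fin.snoc (fun i => dmap f p (stdFrame p i)) (ξ p)) ≠ 0)
    (u : TangentSpace (𝓡 n) p) (a : ℝ) : transCoord Ω f ξ p (dmap f p u + a • ξ p) = a := by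
  have hu : ∀ y : Rn (n + 1),
      (Fin.snoc (fun i => dmap f p (stdFrame p i)) y : Fin (n + 1) → Rn (n + 1)) =
      Function.update (Fin.snoc (fun i => dmap f p (stdFrame p i)) 0 : Fin (n + 1) → Rn (n + 1))
        (Fin.last n) y := by
    exact fun y => (Fin.update_snoc_last (α := fun _ => Rn (n + 1)) ..).symm
  have h0 : Ω (Fin.snoc (fun i => dmap f p (stdFrame p i)) (dmap f p u)) = 0 := by
    refine AlternatingMap.map_linearDependent Ω _ fun hl => ?_
    refine (linearIndependent_finSnoc.1 hl).2 ?_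
    have : u ∈ Submodule.span ℝ (Set.range (stdFrame p)) := by
      rw [← coe_stdBasis, (stdBasis p).span_eq]; trivial
    have := Submodule.mem_map_of_mem (f := dmap f p) this
    rwa [Submodule.map_span, ← Set.range_comp] at this
  rw [transCoord, div_eq_iff h, hu (dmap f p u + a • ξ p), AlternatingMap.map_update_add,
    AlternatingMap.map_update_smul, ← hu, ← hu, h0, zero_add, smul_eq_mul]

/-- The affine fundamental form `α_ξ` of `(f, ξ)`: `α_ξ(u, v) ξ` is the component along `ξ` of
`D_u df(Y)`, where `Y` is a vector field that extends `v`. -/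
def affForm (Ω : VolumeForm n) (f ξ : M → Rn (n + 1)) [IsManifold (𝓡 n) 1 M]
    (p : M) (u v : TangentSpace (𝓡 n) p) : ℝ :=
  transCoord Ω f ξ p (flatDeriv f (FiberBundle.extend (Rn n) v) p u)

/-- `f : (M, ∇, θ) → (R^{n+1}, D, Ω)` is an equiaffine immersion by means of the transversal
vector field `ξ`. In codimension one a transversal bundle `N` with a volume element `θ^⊥` is the
same as a transversal vector field `ξ`, through `N = span {ξ}` and `θ^⊥(ξ) = 1`. The
last two conditions say that `(N, θ^⊥)` induces `∇` and `θ`. -/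
structure IsEquiaffineImmersion [IsManifold (𝓡 n) ∞ M] (Ω : VolumeForm n)
    (cov : CovariantDerivative (𝓡 n) (Rn n) (TangentSpace (𝓡 n) : M → Type _))
    (θ : ∀ p : M, TangentSpace (𝓡 n) p [⋀^Fin n]→ₗ[ℝ] ℝ)
    (f ξ : M → Rn (n + 1)) : Prop where
  smooth : ContMDiff (𝓡 n) 𝓘(ℝ, Rn (n + 1)) ∞ f
  immersion : ∀ p, Function.Injective (dmap f p)
  smooth_field : ContMDiff (𝓡 n) 𝓘(ℝ, Rn (n + 1)) ∞ ξ
  transversal : ∀ p, IsCompl (LinearMap.range (dmap f p)) (Submodule.span ℝ {ξ p})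
  gauss : ∀ Y : ∀ p : M, TangentSpace (𝓡 n) p, SmoothField Y →
    ∀ (p : M) (u : TangentSpace (𝓡 n) p),
      flatDeriv f Y p u = dmap f p (cov Y p u) + affForm Ω f ξ p u (Y p) • ξ p
  volume : ∀ (p : M) (X : Fin n → TangentSpace (𝓡 n) p),
    θ p X = Ω (Fin.snoc (fun i => dmap f p (X i)) (ξ p))

/-! ### Gauss map and Lipschitz-Killing curvature -/

/-- The map `ν̃ : ⋀⁰ N = M × ℝ → ⋀ⁿ R^{n+1}`,
`ν̃(p, t) = t df(e₁) ∧ ⋯ ∧ df(eₙ)` for a frame `e` of `T_p M` with `θ (e) = 1`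
(see `nuTilde_eq`). -/
def nuTilde (θ : ∀ p : M, TangentSpace (𝓡 n) p [⋀^Fin n]→ₗ[ℝ] ℝ) (f : M → Rn (n + 1))
    (p : M) (t : ℝ) : Ext n :=
  t • (θ p (stdFrame p))⁻¹ • exteriorPower.ιMulti ℝ n (fun i => dmap f p (stdFrame p i))

theorem nuTilde_eq (θ : ∀ p : M, TangentSpace (𝓡 n) p [⋀^Fin n]→ₗ[ℝ] ℝ)
    (f : M → Rn (n + 1)) (p : M) (t : ℝ) (e : Fin n → TangentSpace (𝓡 n) p) (he : θ p e = 1) :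
    nuTilde θ f p t = t • exteriorPower.ιMulti ℝ n (fun i => dmap f p (e i)) := by
  have h1 := map_eq_det_smul (stdBasis p) (θ p) e
  have h2 := map_eq_det_smul (stdBasis p)
    ((exteriorPower.ιMulti ℝ n (M := Rn (n + 1))).compLinearMap (dmap f p)) e
  rw [coe_stdBasis] at h1 h2
  rw [he, smul_eq_mul] at h1
  change exteriorPower.ιMulti ℝ n (fun i => dmap f p (e i)) =
    _ • exteriorPower.ιMulti ℝ n (fun i => dmap f p (stdFrame p i)) at h2
  rw [h2, nuTilde, eq_inv_of_mul_eq_one_left h1.symm]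

/-- The transversal ellipsoid bundle `B = ν̃⁻¹(S) ⊆ ⋀⁰ N = M × ℝ`. -/
def ellipsoidBundle (θ : ∀ p : M, TangentSpace (𝓡 n) p [⋀^Fin n]→ₗ[ℝ] ℝ)
    (f : M → Rn (n + 1)) (S : Set (Ext n)) : Set (M × ℝ) :=
  {η | nuTilde θ f η.1 η.2 ∈ S}

/-- The determinant `det_θ b` of a bilinear form `b` on `T_p M`: the determinant of
`[b(e_i, e_j)]` for a frame `e` with `θ (e) = 1` (see `detVol_eq`). -/
def detVol (θ : ∀ p : M, TangentSpace (𝓡 n) p [⋀^Fin n]→ₗ[ℝ] ℝ) (p : M)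
    (b : TangentSpace (𝓡 n) p → TangentSpace (𝓡 n) p → ℝ) : ℝ :=
  (Matrix.of fun i j => b (stdFrame p i) (stdFrame p j)).det / θ p (stdFrame p) ^ 2

theorem detVol_eq (θ : ∀ p : M, TangentSpace (𝓡 n) p [⋀^Fin n]→ₗ[ℝ] ℝ) (p : M)
    (b : LinearMap.BilinForm ℝ (TangentSpace (𝓡 n) p)) (e : Fin n → TangentSpace (𝓡 n) p)
    (he : θ p e = 1) :
    detVol θ p (fun u v => b u v) = (Matrix.of fun i j => b (e i) (e j)).det := by
  have h1 := map_eq_det_smul (stdBasis p) (θ p) e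
  rw [he, smul_eq_mul, coe_stdBasis] at h1
  have hd : (Matrix.of fun i j => b (e i) (e j)) = ((stdBasis p).toMatrix e).transpose *
      (Matrix.of fun i j => b (stdFrame p i) (stdFrame p j)) * (stdBasis p).toMatrix e := by
    ext i j
    have hi : ∀ i, e i = ∑ k, (stdBasis p).toMatrix e k i • stdFrame p k := fun i => by
      rw [← coe_stdBasis]
      exact ((stdBasis p).sum_toMatrix_smul_self e i).symm
    simp only [Matrix.mul_apply, Matrix.of_apply, Matrix.transpose_apply]
    conv_lhs => rw [hi i, hi j]
    simp only [map_sum, map_smul, LinearMap.sum_apply, LinearMap.smul_apply, smul_eq_mul,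
      Finset.mul_sum, Finset.sum_mul]
    refine Finset.sum_congr rfl fun k _ => Finset.sum_congr rfl fun l _ => by ring
  rw [hd, Matrix.det_mul, Matrix.det_mul, Matrix.det_transpose, ← Module.Basis.det_apply, detVol,
    eq_inv_of_mul_eq_one_left h1.symm]
  ring

/-- The Lipschitz-Killing curvature `G(η) = (-1)ⁿ det_θ (h̃_η ∘ α)` at `η = (p, t)`, where
`h̃_η` is the height function of `ν̃(η)` and `α = α_ξ ξ`. -/
def lipschitzKilling (Ω : VolumeForm n) (θ : ∀ p : M, TangentSpace (𝓡 n) p [⋀^Fin n]→ₗ[ℝ] ℝ)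
    (f ξ : M → Rn (n + 1)) [IsManifold (𝓡 n) 1 M] (η : M × ℝ) : ℝ :=
  (-1) ^ n * detVol θ η.1 (fun u v =>
    height Ω (nuTilde θ f η.1 η.2) (affForm Ω f ξ η.1 u v • ξ η.1))

/-! ### Integration and total absolute curvature -/

/-- The measure on `M` given by the density `|θ(∂₁, …, ∂ₙ)| dx₁⋯dxₙ` in the preferred chart at
`x`, and by zero outside its domain. -/
def chartMeasure [MeasurableSpace M] (θ : ∀ p : M, TangentSpace (𝓡 n) p [⋀^Fin n]→ₗ[ℝ] ℝ)
    (x : M) : Measure M :=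
  ((volume.restrict (chartAt (Rn n) x).target).withDensity (fun y => ENNReal.ofReal
    |θ ((chartAt (Rn n) x).symm y) (fun i =>
      mfderiv (𝓡 n) (𝓡 n) (chartAt (Rn n) x).symm y
        (EuclideanSpace.basisFun (Fin n) ℝ i : Rn n))|)).map (chartAt (Rn n) x).symm

/-- The measure `|θ|` on `M`. The chart measures agree on overlaps of charts, and their
supremum is the measure that restricts to each of them on the domain of the chart. -/
def volMeasure [MeasurableSpace M] (θ : ∀ p : M, TangentSpace (𝓡 n) p [⋀^Fin n]→ₗ[ℝ] ℝ) :
    Measure M :=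
  ⨆ x : M, chartMeasure θ x

/-- The total absolute curvature
`τ_S(f) = (1 / vol (unit n-sphere)) ∫_B |G| ω_B`.

The volume element `ω_B` is the contraction of the volume element `dt ∧ θ` of
`⋀⁰ N = M × ℝ` with the position field `t ∂_t`, that is, `ω_B = t θ` at `(p, t) ∈ B`; with this
normalization `ν^* ω_S = ± G ω_B`, where `ω_S` is the contraction of `ω'` with the position
vector. As `B → M` is a local diffeomorphism (the fibres are `{μ(p), -μ(p)}`), the integral over
`B` is the integral over `M` of the sum over the fibres. -/
def totalAbsCurv [MeasurableSpace M] [IsManifold (𝓡 n) 1 M] (Ω : VolumeForm n)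
    (θ : ∀ p : M, TangentSpace (𝓡 n) p [⋀^Fin n]→ₗ[ℝ] ℝ) (f ξ : M → Rn (n + 1))
    (S : Set (Ext n)) : ENNReal :=
  (∫⁻ p, ∑' t : {t : ℝ // (p, t) ∈ ellipsoidBundle θ f S},
      ENNReal.ofReal (|lipschitzKilling Ω θ f ξ (p, t)| * |(t : ℝ)|) ∂(volMeasure θ)) /
    (volume : Measure (Rn (n + 1))).toSphere Set.univ

/-- `f` is a (closed) convex hypersurface: it embeds `M` onto the boundary of a compact convex set
with nonempty interior. -/
def IsConvexHypersurface (f : M → Rn (n + 1)) : Prop :=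
  Topology.IsEmbedding f ∧ ∃ K : Set (Rn (n + 1)),
    Convex ℝ K ∧ IsCompact K ∧ (interior K).Nonempty ∧ Set.range f = frontier K

end Manifold

end Equiaffine

end

noncomputable section

namespace Equiaffine

/-! ### Coordinates on the dual space adapted to a unit ellipsoid -/

/-! Let λ(p) be the conormal covector: it kills df(T_pM) and is 1 on ξ_p. The height function of
ν̃(p, t) is t λ(p), so everything can be read in the dual space. There the ellipsoid S becomes the
unit sphere of linear coordinates Q whose Lebesgue measure is dual to Ω
(`IsUnitEllipsoid.exists_coords`).

The cone map (p, t) ↦ t λ(p) has Jacobian |t|^n |det_θ α| with respect to |θ| dt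
(`abs_det_fderiv_coneMap`); this is |G|. Since |G| is homogeneous of degree n in t, the sum of |G|
|t| over the two points of a fibre of B is n + 1 times the integral of |G| over the segment between
them (`tsum_fibre`). Hence the integral over B is n + 1 times the volume of the unit ball of the
dual space, counted with the multiplicity of the cone map.

Convexity makes this multiplicity 2 almost everywhere (`sum_lintegral_coneDomain`). A nonzero
covector has a maximum and a minimum on the body, both on its boundary, and at each it is a multiple
of λ. Conversely the supporting hyperplane at f(p) is the tangent plane, so every t λ(p) is maximal
or minimal at p. If the maximum is attained at two points, it is attained along the segment between
them; the cone map then repeats a value arbitrarily close to a preimage, so its derivative is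
singular there. Such critical values form a null set. The result is 2 (n + 1) vol(ball), and (n + 1)
vol(ball) is the volume of the unit sphere. -/

instance instT2SpaceRn (k : ℕ) : T2Space (Rn k) := TopologicalSpace.t2Space_of_metrizableSpace

/-- `height` as a linear map from `⋀ⁿ R^{n+1}` to the dual of `R^{n+1}`. -/
def heightDual {n : ℕ} (Ω : VolumeForm n) : Ext n →ₗ[ℝ] (Rn (n + 1) →L[ℝ] ℝ) :=
  (LinearMap.toContinuousLinearMap (𝕜 := ℝ) (E := Rn (n + 1)) (F' := ℝ)).toLinearMap ∘ₗ
    LinearMap.mk₂ ℝ (height Ω)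
      (fun a b x => by simp [height, mul_add])
      (fun c a x => by simp [height]; ring)
      (fun a x y => by simp [height, mul_add])
      (fun c a x => by simp [height]; ring)

@[simp] theorem heightDual_apply {n : ℕ} (Ω : VolumeForm n) (φ : Ext n) (x : Rn (n + 1)) :
    heightDual Ω φ x = height Ω φ x := rfl

theorem exists_volume_eq_one {n : ℕ} {Ω : VolumeForm n} (hΩ : Ω ≠ 0) :
    ∃ b : Module.Basis (Fin (n + 1)) ℝ (Rn (n + 1)), Ω b = 1 := by
  obtain ⟨v, hv⟩ : ∃ v, Ω v ≠ 0 := by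
    by_contra! h
    exact hΩ (AlternatingMap.ext h)
  have h1 : Ω (Function.update v 0 ((Ω v)⁻¹ • v 0)) = 1 := by
    rw [AlternatingMap.map_update_smul, Function.update_eq_self, smul_eq_mul, inv_mul_cancel₀ hv]
  have hli : LinearIndependent ℝ (Function.update v 0 ((Ω v)⁻¹ • v 0)) := by
    by_contra hd
    rw [AlternatingMap.map_linearDependent Ω _ hd] at h1
    exact zero_ne_one h1
  exact ⟨basisOfLinearIndependentOfCardEqFinrank hli (by simp), by simpa using h1⟩

/-- The heights of the `n`-fold wedges of a unimodular basis form the dual basis up to sign. -/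
theorem abs_det_height_wedge {n : ℕ} {Ω : VolumeForm n} (b : Fin (n + 1) → Rn (n + 1))
    (hb : Ω b = 1) :
    |(Matrix.of fun i j => height Ω (exteriorPower.ιMulti ℝ n (fun k => b (Fin.succAbove i k)))
      (b j)).det| = 1 := by
  have hs : ∀ i j, (Fin.snoc (fun k => b (Fin.succAbove i k)) (b j) : Fin (n + 1) → Rn (n + 1)) =
      b ∘ (Fin.snoc i.succAbove j : Fin (n + 1) → Fin (n + 1)) := fun i j =>
    (Fin.comp_snoc b i.succAbove j).symm
  have hdiag : (Matrix.of fun i j => height Ω (exteriorPower.ιMulti ℝ n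
      (fun k => b (Fin.succAbove i k))) (b j)) =
      Matrix.diagonal fun i => Ω (Fin.snoc (fun k => b (Fin.succAbove i k)) (b i)) := by
    ext i j
    rw [Matrix.of_apply, height_wedge, Matrix.diagonal_apply]
    split_ifs with h
    · rw [h]
    -- Off the diagonal `b j` already occurs in the wedge that omits only `b i`, so Ω has a repeated
    -- argument.
    · obtain ⟨k, hk⟩ := Fin.exists_succAbove_eq (Ne.symm h)
      refine AlternatingMap.map_eq_zero_of_eq Ω _ (i := k.castSucc) (j := Fin.last n) ?_
        (Fin.castSucc_lt_last k).ne
      simp [hk]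
  rw [hdiag, Matrix.det_diagonal, Finset.abs_prod]
  refine Finset.prod_eq_one fun i _ => ?_
  -- On the diagonal the arguments are a permutation of `b`, which gives ±1.
  have hinj : Function.Injective (Fin.snoc i.succAbove i : Fin (n + 1) → Fin (n + 1)) := by
    rw [Fin.snoc_injective_iff]
    exact ⟨Fin.succAbove_right_injective, by simp⟩
  have hσ : b ∘ (Fin.snoc i.succAbove i : Fin (n + 1) → Fin (n + 1)) =
      b ∘ (Equiv.ofBijective _ (Finite.injective_iff_bijective.1 hinj) : Equiv.Perm _) := rfl
  rw [hs, hσ, AlternatingMap.map_perm, hb]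
  rcases Int.units_eq_one_or (Equiv.Perm.sign
    (Equiv.ofBijective _ (Finite.injective_iff_bijective.1 hinj) : Equiv.Perm _)) with h | h <;>
  simp [h]

/-- Both determinants are alternating of top degree in `v`, so it suffices to compare them on one
basis with Ω = 1. There the normalization of `ζ` says that the passage from `ζ` to the wedges has
determinant ±1, and the heights of the wedges are known. -/
theorem abs_det_height_basis {n : ℕ} {Ω : VolumeForm n} (hΩ : Ω ≠ 0)
    (ζ : Module.Basis (Fin (n + 1)) ℝ (Ext n))
    (hζ : ∀ v : Fin (n + 1) → Rn (n + 1), Ω v = 1 →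
      ζ.det (fun i => exteriorPower.ιMulti ℝ n (fun j => v (i.succAbove j))) =
        (-1) ^ ((n + 1) * n / 2)) (v : Fin (n + 1) → Rn (n + 1)) :
    |(Matrix.of fun i j => height Ω (ζ i) (v j)).det| = |Ω v| := by
  obtain ⟨b, hb⟩ := exists_volume_eq_one hΩ
  have h1 : |(Matrix.of fun i j => height Ω (ζ i) (b j)).det| = 1 := by
    have hmul : (Matrix.of fun i j => height Ω (exteriorPower.ιMulti ℝ n
        (fun k => b (Fin.succAbove i k))) (b j)) =
        (ζ.toMatrix (fun i => exteriorPower.ιMulti ℝ n (fun j => b (Fin.succAbove i j)))).transpose *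
          (Matrix.of fun i j => height Ω (ζ i) (b j)) := by
      ext i j
      simp only [Matrix.mul_apply, Matrix.of_apply, Matrix.transpose_apply, ← heightDual_apply]
      conv_lhs => rw [← ζ.sum_toMatrix_smul_self
        (fun i => exteriorPower.ιMulti ℝ n (fun j => b (Fin.succAbove i j))) i]
      rw [map_sum, sum_apply]
      exact Finset.sum_congr rfl fun k _ => by rw [map_smul]; rfl
    have h2 := abs_det_height_wedge b hb
    rw [hmul, Matrix.det_mul, Matrix.det_transpose, ← Module.Basis.det_apply, hζ b hb, abs_mul,
      abs_pow, abs_neg, abs_one, one_pow, one_mul] at h2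
    exact h2
  let A : VolumeForm n := (Matrix.detRowAlternating (n := Fin (n + 1)) (R := ℝ)).compLinearMap
    (LinearMap.pi fun i => (heightDual Ω (ζ i)).toLinearMap)
  have hA : ∀ v, A v = (Matrix.of fun i j => height Ω (ζ i) (v j)).det := fun v => by
    rw [← Matrix.det_transpose]; rfl
  have e1 := map_eq_det_smul b A v
  have e2 := map_eq_det_smul b Ω v
  rw [hA, hA] at e1
  rw [e1, e2, smul_eq_mul, smul_eq_mul, abs_mul, abs_mul, h1, hb, abs_one]

/-- Coordinates on the dual of `R^{n+1}` in which the heights of `S` form the unit sphere, and in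
which Lebesgue measure is the one dual to `Ω`. -/
theorem IsUnitEllipsoid.exists_coords {n : ℕ} {Ω : VolumeForm n} (hΩ : Ω ≠ 0) {S : Set (Ext n)}
    (hS : IsUnitEllipsoid Ω S) :
    ∃ Q : (Rn (n + 1) →L[ℝ] ℝ) ≃L[ℝ] Rn (n + 1),
      (∀ φ, φ ∈ S ↔ ‖Q (heightDual Ω φ)‖ = 1) ∧
      ∀ v : Fin (n + 1) → Rn (n + 1),
        |(Matrix.of fun i j => Q.symm (EuclideanSpace.basisFun (Fin (n + 1)) ℝ i) (v j)).det| =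
          |Ω v| := by
  obtain ⟨ζ, hζ, rfl⟩ := hS
  have hdet := abs_det_height_basis hΩ ζ hζ
  obtain ⟨b, hb⟩ := exists_volume_eq_one hΩ
  have hli : LinearIndependent ℝ fun i => heightDual Ω (ζ i) := by
    rw [Fintype.linearIndependent_iff]
    intro g hg
    have hM : (Matrix.of fun i j => height Ω (ζ i) (b j)).det ≠ 0 := by
      intro h
      have := hdet b
      rw [h, hb] at this
      simp at this
    have : Matrix.vecMul g (Matrix.of fun i j => height Ω (ζ i) (b j)) = 0 := by
      ext j
      have := congrArg (fun L : Rn (n + 1) →L[ℝ] ℝ => L (b j)) hg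
      simpa [Matrix.vecMul, dotProduct] using this
    exact fun i => congrFun (Matrix.eq_zero_of_vecMul_eq_zero hM this) i
  have hcard : Fintype.card (Fin (n + 1)) = Module.finrank ℝ (Rn (n + 1) →L[ℝ] ℝ) := by
    rw [← LinearEquiv.finrank_eq (LinearMap.toContinuousLinearMap (𝕜 := ℝ) (E := Rn (n + 1))
      (F' := ℝ)), Module.finrank_linearMap]
    simp
  let B := basisOfLinearIndependentOfCardEqFinrank hli hcard
  have hB : ∀ i, B i = heightDual Ω (ζ i) := fun i => by simp [B]
  let Q := (B.equiv (EuclideanSpace.basisFun (Fin (n + 1)) ℝ).toBasis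
    (Equiv.refl _)).toContinuousLinearEquiv
  have hQ : ∀ i, Q (heightDual Ω (ζ i)) = EuclideanSpace.basisFun (Fin (n + 1)) ℝ i := fun i => by
    rw [← hB]
    simp [Q, -EuclideanSpace.basisFun_apply]
  have hQs : ∀ a : Fin (n + 1) → ℝ,
      ‖Q (heightDual Ω (∑ i, a i • ζ i))‖ = Real.sqrt (∑ i, a i ^ 2) := fun a => by
    rw [map_sum, map_sum, EuclideanSpace.norm_eq]
    simp [hQ, Finset.sum_apply, Pi.single_apply]
  refine ⟨Q, fun φ => ⟨?_, fun h => ⟨ζ.repr φ, ?_, (ζ.sum_repr φ).symm⟩⟩, fun v => ?_⟩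
  · rintro ⟨a, ha, rfl⟩
    rw [hQs, ha, Real.sqrt_one]
  · rw [← ζ.sum_repr φ, hQs, Real.sqrt_eq_one] at h
    exact h
  · rw [← hdet v]
    simp_rw [← hQ, ContinuousLinearEquiv.symm_apply_apply, heightDual_apply]

/-! ### Linear functionals on the boundary of a convex body -/

section Convex

open Set Filter

variable {V : Type*} [NormedAddCommGroup V] [NormedSpace ℝ V] {K : Set V}

/-- Hahn–Banach separates the point from the open interior; the weak inequality passes to the
closure of the interior, which contains `K`. -/
theorem exists_supporting_functional (hK : Convex ℝ K) (hi : (interior K).Nonempty) {x : V}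
    (hx : x ∈ frontier K) : ∃ l : V →L[ℝ] ℝ, l ≠ 0 ∧ ∀ y ∈ K, l y ≤ l x := by
  obtain ⟨l, hl⟩ := geometric_hahn_banach_open_point hK.interior isOpen_interior hx.2
  refine ⟨l, ?_, fun y hy => ?_⟩
  · rintro rfl
    obtain ⟨z, hz⟩ := hi
    exact lt_irrefl _ (hl z hz)
  · have hc : y ∈ closure (interior K) := by
      rw [hK.closure_interior_eq_closure_of_nonempty_interior hi]
      exact subset_closure hy
    have : closure (interior K) ⊆ {z | l z ≤ l x} :=
      closure_minimal (fun z hz => (hl z hz).le) (isClosed_le l.continuous continuous_const)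
    exact this hc

/-- A linear functional is its own derivative, so a local maximum in the interior would force it to
be zero. -/
theorem mem_frontier_of_forall_le {l : V →L[ℝ] ℝ} (hl : l ≠ 0) {x : V} (hx : x ∈ K)
    (h : ∀ y ∈ K, l y ≤ l x) : x ∈ frontier K := by
  refine ⟨subset_closure hx, fun hxi => hl ?_⟩
  have : IsLocalMax l x := by
    filter_upwards [mem_interior_iff_mem_nhds.1 hxi] with y hy using h y hy
  simpa using this.fderiv_eq_zero

variable {M : Type*} {f : M → V}

/-- The linear functional `l` is maximal on the hypersurface `f` at the point `p`. -/
def IsMaxAt (f : M → V) (l : V →L[ℝ] ℝ) (p : M) : Prop := ∀ q, l (f q) ≤ l (f p)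

theorem exists_isMaxAt (hc : IsCompact K) (hi : (interior K).Nonempty)
    (hf : range f = frontier K) {l : V →L[ℝ] ℝ} (hl : l ≠ 0) :
    ∃ p, IsMaxAt f l p ∧ ∀ y ∈ K, l y ≤ l (f p) := by
  obtain ⟨x, hx, hm⟩ := hc.exists_isMaxOn (hi.mono interior_subset) l.continuous.continuousOn
  have hx' := mem_frontier_of_forall_le hl hx hm
  rw [← hf] at hx'
  obtain ⟨p, rfl⟩ := hx'
  refine ⟨p, fun q => ?_, hm⟩
  refine hm (hc.isClosed.frontier_subset ?_)
  rw [← hf]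
  exact mem_range_self q

theorem IsMaxAt.forall_le (hc : IsCompact K) (hi : (interior K).Nonempty)
    (hf : range f = frontier K) {l : V →L[ℝ] ℝ} (hl : l ≠ 0) {p : M} (hp : IsMaxAt f l p) :
    ∀ y ∈ K, l y ≤ l (f p) := fun y hy => by
  obtain ⟨q, -, hq⟩ := exists_isMaxAt hc hi hf hl
  exact (hq y hy).trans (hp q)

/-- Otherwise `l` would be constant on `K`, and an interior point would be a maximum. -/
theorem not_isMaxAt_neg (hc : IsCompact K) (hi : (interior K).Nonempty)
    (hf : range f = frontier K) {l : V →L[ℝ] ℝ} (hl : l ≠ 0) {p : M} (hp : IsMaxAt f l p) :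
    ¬ IsMaxAt f (-l) p := fun hn => by
  obtain ⟨z, hz⟩ := hi
  have h1 := hp.forall_le hc ⟨z, hz⟩ hf hl
  have h2 := hn.forall_le hc ⟨z, hz⟩ hf (neg_ne_zero.2 hl)
  simp only [neg_apply, neg_le_neg_iff] at h2
  have hzK := interior_subset hz
  exact (mem_frontier_of_forall_le hl hzK fun y hy => (h1 y hy).trans (h2 z hzK)).2 hz

/-- If two distinct points maximize `l`, then so do points arbitrarily close to the first one. -/
theorem IsMaxAt.frequently [TopologicalSpace M] (hK : Convex ℝ K) (hc : IsCompact K)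
    (hi : (interior K).Nonempty) (hf : range f = frontier K) (he : Topology.IsEmbedding f)
    {l : V →L[ℝ] ℝ} (hl : l ≠ 0) {p q : M} (hp : IsMaxAt f l p) (hq : IsMaxAt f l q)
    (hpq : p ≠ q) : ∃ᶠ p' in 𝓝[≠] p, IsMaxAt f l p' := by
  have hmem : ∀ r, f r ∈ K := fun r => hc.isClosed.frontier_subset (hf ▸ mem_range_self r)
  have hlpq : l (f q) = l (f p) := le_antisymm (hp q) (hq p)
  have hle := hp.forall_le hc hi hf hl
  -- Along the segment from `f p` to `f q` the functional keeps its maximal value, so the segment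
  -- lies in the boundary, hence in the image of `f`.
  have hfr : ∀ s ∈ Ioo (0 : ℝ) 1, ∃ p', p' ≠ p ∧ f p' = f p + s • (f q - f p) ∧
      IsMaxAt f l p' := fun s hs => by
    have hls : l (f p + s • (f q - f p)) = l (f p) := by simp [hlpq]
    have hK' : f p + s • (f q - f p) ∈ K :=
      hK.add_smul_sub_mem (hmem p) (hmem q) ⟨hs.1.le, hs.2.le⟩
    have := mem_frontier_of_forall_le hl hK' fun y hy => (hle y hy).trans hls.ge
    rw [← hf] at this
    obtain ⟨p', hp'⟩ := this
    refine ⟨p', ?_, hp', fun r => ?_⟩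
    · rintro rfl
      have h0 : s • (f q - f p') = 0 := by simpa using hp'
      rcases smul_eq_zero.1 h0 with h0 | h0
      · exact hs.1.ne' h0
      · exact hpq (he.injective (sub_eq_zero.1 h0)).symm
    · rw [hp', hls]
      exact hp r
  -- Since `f` is an embedding, the preimages of segment points near `f p` are near `p`.
  rw [frequently_iff]
  intro U hU
  rw [mem_nhdsWithin_iff_exists_mem_nhds_inter, he.nhds_eq_comap] at hU
  obtain ⟨U', hU', hUU⟩ := hU
  obtain ⟨W, hW, hWU⟩ := mem_comap.1 hU'
  have ht : Tendsto (fun s : ℝ => f p + s • (f q - f p)) (𝓝[>] 0) (𝓝 (f p)) := by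
    have : ContinuousAt (fun s : ℝ => f p + s • (f q - f p)) 0 := by fun_prop
    have h := this.tendsto
    simp only [zero_smul, add_zero] at h
    exact h.mono_left nhdsWithin_le_nhds
  obtain ⟨s, hsW, hs⟩ := ((ht.eventually hW).and (Ioo_mem_nhdsGT one_pos)).exists
  obtain ⟨p', hne, hfp, hmax⟩ := hfr s hs
  exact ⟨p', hUU ⟨hWU (show f p' ∈ W by rw [hfp]; exact hsW), hne⟩, hmax⟩

end Convex

/-! ### Multiplicity of the cone map and the area formula -/

section AreaFormula

set_option linter.unusedSectionVars false

open Set Filter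

theorem _root_.ContinuousOn.measurableSet_inter_preimage {X Y : Type*} [TopologicalSpace X]
    [MeasurableSpace X] [BorelSpace X] [TopologicalSpace Y] [MeasurableSpace Y] [BorelSpace Y]
    {T : Set X} {g : X → Y} (hg : ContinuousOn g T) (hT : MeasurableSet T) {A : Set Y}
    (hA : MeasurableSet A) : MeasurableSet (T ∩ g ⁻¹' A) := by
  have h := hT.subtype_image ((continuousOn_iff_continuous_domRestrict.1 hg).measurable hA)
  convert h using 1
  ext z
  simp [and_comm]

variable {V : Type*} [NormedAddCommGroup V] [NormedSpace ℝ V] {K : Set V}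
  {M : Type*} [TopologicalSpace M] [MeasurableSpace M] [BorelSpace M] {f ξ : M → V}
  {Y : Type*} [NormedAddCommGroup Y] [NormedSpace ℝ Y] [FiniteDimensional ℝ Y]
  [MeasurableSpace Y] [BorelSpace Y]
  {ι : Type*} [Fintype ι] {lam : M → V →L[ℝ] ℝ} {A : ι → Set M}
  {e : ι → OpenPartialHomeomorph M Y} {J : (V →L[ℝ] ℝ) ≃L[ℝ] (Y × ℝ)}
  {G : Set (V →L[ℝ] ℝ)}

/-- The cone map `(y, t) ↦ t λ(y)` on a chart, in the coordinates `J` of the dual space. -/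
def coneMap (J : (V →L[ℝ] ℝ) ≃L[ℝ] (Y × ℝ)) (lam : M → V →L[ℝ] ℝ)
    (e : OpenPartialHomeomorph M Y) (z : Y × ℝ) : Y × ℝ :=
  J (z.2 • lam (e.symm z.1))

/-- The part over `A` of the domain on which the cone map takes values in `J '' G`. -/
def coneDomain (lam : M → V →L[ℝ] ℝ) (e : OpenPartialHomeomorph M Y) (A : Set M)
    (G : Set (V →L[ℝ] ℝ)) : Set (Y × ℝ) :=
  {z | z.1 ∈ e.target ∧ e.symm z.1 ∈ A ∧ z.2 • lam (e.symm z.1) ∈ G}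

/-- The part of the cone domain on which the covector `s t λ` is maximal at its base point. -/
def coneDomainMax (f : M → V) (lam : M → V →L[ℝ] ℝ) (e : OpenPartialHomeomorph M Y) (A : Set M)
    (G : Set (V →L[ℝ] ℝ)) (s : ℝ) : Set (Y × ℝ) :=
  {z ∈ coneDomain lam e A G |
    z.2 ≠ 0 ∧ IsMaxAt f (s • z.2 • lam (e.symm z.1)) (e.symm z.1)}

theorem continuousOn_smul_symm {e : OpenPartialHomeomorph M Y} (hlam : ContinuousOn lam e.source) :
    ContinuousOn (fun z : Y × ℝ => z.2 • lam (e.symm z.1)) (e.target ×ˢ univ) := by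
  refine continuousOn_snd.smul (hlam.comp (e.continuousOn_symm.comp continuousOn_fst ?_) ?_)
  · exact fun z hz => hz.1
  · exact fun z hz => e.map_target hz.1

theorem measurableSet_coneDomain {e : OpenPartialHomeomorph M Y} {A : Set M}
    (hlam : ContinuousOn lam e.source) (hA : MeasurableSet A) (hG : IsOpen G) :
    MeasurableSet (coneDomain lam e A G) := by
  have hT : MeasurableSet (e.target ×ˢ (univ : Set ℝ)) :=
    e.open_target.measurableSet.prod MeasurableSet.univ
  have h1 := ContinuousOn.measurableSet_inter_preimage (g := fun z : Y × ℝ => e.symm z.1)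
    (e.continuousOn_symm.comp continuousOn_fst fun z hz => hz.1) hT hA
  have h2 : MeasurableSet (e.target ×ˢ (univ : Set ℝ) ∩
      (fun z : Y × ℝ => z.2 • lam (e.symm z.1)) ⁻¹' G) :=
    ((continuousOn_smul_symm hlam).isOpen_inter_preimage
      (e.open_target.prod isOpen_univ) hG).measurableSet
  convert h1.inter h2 using 1
  ext z
  simp only [coneDomain, mem_ofPred_eq, mem_inter_iff, mem_prod, mem_univ, and_true, mem_preimage]
  tauto

theorem measurableSet_coneDomainMax {e : OpenPartialHomeomorph M Y} {A : Set M}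
    (hf : Continuous f) (hlam : ContinuousOn lam e.source) (hA : MeasurableSet A) (hG : IsOpen G)
    (s : ℝ) : MeasurableSet (coneDomainMax f lam e A G s) := by
  have hT : MeasurableSet (e.target ×ˢ (univ : Set ℝ)) :=
    e.open_target.measurableSet.prod MeasurableSet.univ
  have h1 : MeasurableSet ((e.target ×ˢ (univ : Set ℝ)) ∩
      {z | IsMaxAt f (s • z.2 • lam (e.symm z.1)) (e.symm z.1)}) := by
    have hc := continuousOn_iff_continuous_domRestrict.1 (continuousOn_smul_symm hlam)
    have hc' := continuousOn_iff_continuous_domRestrict.1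
      (e.continuousOn_symm.comp (continuousOn_fst (s := e.target ×ˢ (univ : Set ℝ)))
        fun z hz => hz.1)
    -- Maximality is an uncountable family of inequalities in `q`; each is closed, so their
    -- intersection is still measurable.
    have hcl : IsClosed {w : ↥(e.target ×ˢ (univ : Set ℝ)) |
        IsMaxAt f (s • w.1.2 • lam (e.symm w.1.1)) (e.symm w.1.1)} := by
      simp only [IsMaxAt, ofPred_forall]
      refine isClosed_iInter fun q => isClosed_le ?_ ?_
      · exact (hc.const_smul s).clm_apply continuous_const
      · exact (hc.const_smul s).clm_apply (hf.comp hc')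
    convert hT.subtype_image hcl.measurableSet using 1
    ext z
    simp [and_comm]
  have h0 : MeasurableSet {z : Y × ℝ | z.2 ≠ 0} :=
    measurable_snd (measurableSet_singleton (0 : ℝ)).compl
  convert ((measurableSet_coneDomain hlam hA hG).inter h1).inter h0 using 1
  ext z
  simp only [coneDomain, coneDomainMax, mem_ofPred_eq, mem_inter_iff, mem_prod, mem_univ, and_true]
  tauto

variable (hK : Convex ℝ K) (hc : IsCompact K) (hi : (interior K).Nonempty)
  (hr : range f = frontier K) (he : Topology.IsEmbedding f) (hξ : Continuous ξ)
  (hcrit : ∀ (l : V →L[ℝ] ℝ) (p : M), IsMaxAt f l p → l = l (ξ p) • lam p)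
  (hone : ∀ p, lam p (ξ p) = 1)
include hK hc hi hr he hξ hcrit hone

/-- At regular points of the cone map a maximized covector is maximized nowhere else. -/
theorem eq_of_isMaxAt_of_det_ne_zero {e : OpenPartialHomeomorph M Y} {s : ℝ} (hs : s ≠ 0)
    {z : Y × ℝ} (hz : z.1 ∈ e.target) (ht : z.2 ≠ 0)
    (hd : DifferentiableAt ℝ (coneMap J lam e) z) (hdet : (fderiv ℝ (coneMap J lam e) z).det ≠ 0)
    (hmax : IsMaxAt f (s • z.2 • lam (e.symm z.1)) (e.symm z.1)) {q : M}
    (hq : IsMaxAt f (s • z.2 • lam (e.symm z.1)) q) : e.symm z.1 = q := by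
  by_contra hne
  set p := e.symm z.1 with hp
  set l := z.2 • lam p with hl
  have hlξ : l (ξ p) = z.2 := by simp [hl, hone]
  have hl0 : s • l ≠ 0 := by
    intro h
    have := congrArg (fun L : V →L[ℝ] ℝ => L (ξ p)) h
    simp [hlξ, hs, ht] at this
  have hfreq := IsMaxAt.frequently hK hc hi hr he hl0 hmax hq hne
  have hps : p ∈ e.source := e.map_target hz
  -- If `s • l` is also maximal at `p'`, then `l = l (ξ p') • lam p'`, so the cone map takes the
  -- value `J l` at `(e p', l (ξ p'))`. These points tend to `z` and differ from it.
  have htend : Tendsto (fun p' => (e p', l (ξ p'))) (𝓝[≠] p) (𝓝[≠] z) := by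
    refine tendsto_nhdsWithin_iff.2 ⟨?_, ?_⟩
    · have h1 : Tendsto (fun p' => (e p', l (ξ p'))) (𝓝 p) (𝓝 (e p, l (ξ p))) :=
        (e.continuousAt hps).tendsto.prodMk_nhds ((l.continuous.comp hξ).tendsto p)
      rw [hlξ, hp, e.right_inv hz] at h1
      exact h1.mono_left nhdsWithin_le_nhds
    · filter_upwards [self_mem_nhdsWithin,
        mem_nhdsWithin_of_mem_nhds (e.open_source.mem_nhds hps)] with p' hp' hps' h
      refine hp' (e.injOn hps' hps ?_)
      rw [hp, e.right_inv hz]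
      exact congrArg Prod.fst h
  -- An invertible derivative is bounded below, so near `z` the value at `z` is not repeated.
  have hanti : ∃ C, AntilipschitzWith C (fderiv ℝ (coneMap J lam e) z) := by
    refine ⟨_, ContinuousLinearEquiv.antilipschitz
      ((fderiv ℝ (coneMap J lam e) z).toContinuousLinearEquivOfDetNeZero hdet)⟩
  have hev := htend.eventually
    (hd.hasFDerivAt.eventually_ne (c := coneMap J lam e z) hanti)
  obtain ⟨p', hmax', hne', hps'⟩ := (hfreq.and_eventually (hev.and
    (mem_nhdsWithin_of_mem_nhds (e.open_source.mem_nhds hps)))).exists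
  refine hne' ?_
  have h := hcrit _ _ hmax'
  rw [smul_apply, smul_eq_mul, mul_smul] at h
  have h' := smul_right_injective _ hs h
  simp only [coneMap, e.left_inv hps']
  rw [← h']

/-- Up to a null set each covector of `G` is hit exactly once by points whose covector, times `s`,
is maximal at the base point: compactness gives a hit, and regular hits are unique. Critical points
contribute nothing to the integral and have null image. As the sets `A i` partition `M`, no point is
counted in two charts. -/
theorem sum_lintegral_coneDomainMax (hlam : ∀ i, ContinuousOn lam (e i).source)
    (hA : ∀ i, MeasurableSet (A i)) (hAd : Pairwise (Function.onFun Disjoint A))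
    (hAs : ∀ i, A i ⊆ (e i).source) (hAc : ⋃ i, A i = univ) (hG : IsOpen G)
    (hd : ∀ i, ∀ z : Y × ℝ, z.1 ∈ (e i).target → DifferentiableAt ℝ (coneMap J lam (e i)) z)
    (μ : Measure (Y × ℝ)) [μ.IsAddHaarMeasure] {s : ℝ} (hs : s ≠ 0) :
    ∑ i, ∫⁻ z in coneDomainMax f lam (e i) (A i) G s,
      ENNReal.ofReal |(fderiv ℝ (coneMap J lam (e i)) z).det| ∂μ = μ (J '' G) := by
  let D : ι → Set (Y × ℝ) := fun i => coneDomainMax f lam (e i) (A i) G s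
  let Z : ι → Set (Y × ℝ) := fun i => {z | (fderiv ℝ (coneMap J lam (e i)) z).det = 0}
  have hD : ∀ i, MeasurableSet (D i) := fun i =>
    measurableSet_coneDomainMax he.continuous (hlam i) (hA i) hG s
  have hZ : ∀ i, MeasurableSet (Z i) := fun i =>
    (ContinuousLinearMap.continuous_det.measurable.comp
      (measurable_fderiv ℝ (coneMap J lam (e i)))) (measurableSet_singleton 0)
  have hder : ∀ i, ∀ T, ∀ z ∈ D i ∩ T, HasFDerivWithinAt (coneMap J lam (e i))
      (fderiv ℝ (coneMap J lam (e i)) z) (D i ∩ T) z := fun i T z hz =>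
    (hd i z hz.1.1.1).hasFDerivAt.hasFDerivWithinAt
  -- Regularity at one of the two points suffices. It gives injectivity on each piece and
  -- disjointness of the images of different pieces.
  have key : ∀ i j, ∀ z ∈ D i \ Z i, ∀ w ∈ D j,
      coneMap J lam (e i) z = coneMap J lam (e j) w → i = j ∧ z = w := by
    intro i j z hz w hw hzw
    have hzw' := J.injective hzw
    have hp : (e i).symm z.1 = (e j).symm w.1 :=
      eq_of_isMaxAt_of_det_ne_zero hK hc hi hr he hξ hcrit hone hs hz.1.1.1 hz.1.2.1
        (hd i z hz.1.1.1) hz.2 hz.1.2.2 (by rw [hzw']; exact hw.2.2)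
    have hij : i = j := by
      by_contra hne
      exact Set.disjoint_left.1 (hAd hne) hz.1.1.2.1 (hp ▸ hw.1.2.1)
    subst hij
    refine ⟨rfl, Prod.ext ((e i).symm.injOn hz.1.1.1 hw.1.1 hp) ?_⟩
    have := congrArg (fun L : V →L[ℝ] ℝ => L (ξ ((e i).symm z.1))) hzw'
    rw [← hp] at this
    simpa [hone] using this
  have hinj : ∀ i, InjOn (coneMap J lam (e i)) (D i \ Z i) := fun i z hz w hw h =>
    (key i i z hz w hw.1 h).2
  have hint : ∀ i, ∫⁻ z in D i, ENNReal.ofReal |(fderiv ℝ (coneMap J lam (e i)) z).det| ∂μ =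
      μ (coneMap J lam (e i) '' (D i \ Z i)) := by
    intro i
    rw [← lintegral_inter_add_sdiff _ (D i) (hZ i), lintegral_abs_det_fderiv_eq_addHaar_image μ
      ((hD i).diff (hZ i)) (hder i _) (hinj i), setLIntegral_congr_fun ((hD i).inter (hZ i))
      (g := fun _ => 0) (fun z hz => by
        have : (fderiv ℝ (coneMap J lam (e i)) z).det = 0 := hz.2
        simp [this])]
    simp
  have hdisj : Pairwise (Function.onFun Disjoint fun i => coneMap J lam (e i) '' (D i \ Z i)) := by
    intro i j hij
    refine Set.disjoint_left.2 ?_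
    rintro _ ⟨z, hz, rfl⟩ ⟨w, hw, h⟩
    exact hij (key i j z hz w hw.1 h.symm).1
  have hsum : ∑ i, μ (coneMap J lam (e i) '' (D i \ Z i)) =
      μ (⋃ i, coneMap J lam (e i) '' (D i \ Z i)) := by
    rw [measure_iUnion hdisj fun i => measurable_image_of_fderivWithin
      ((hD i).diff (hZ i)) (hder i _) (hinj i), tsum_fintype]
  rw [Finset.sum_congr rfl fun i _ => hint i, hsum]
  refine le_antisymm (measure_mono ?_) ?_
  · refine iUnion_subset fun i => ?_
    rintro _ ⟨z, hz, rfl⟩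
    exact mem_image_of_mem J hz.1.1.2.2
  -- A maximum point `p` of `s • l` provides the preimage `(e i p, l (ξ p))` of `J l`; only `l = 0`
  -- and images of critical points need to be discarded.
  · have hsub : J '' G ⊆ (⋃ i, coneMap J lam (e i) '' (D i \ Z i)) ∪
        ((⋃ i, coneMap J lam (e i) '' (D i ∩ Z i)) ∪ {0}) := by
      rintro _ ⟨l, hl, rfl⟩
      by_cases hl0 : l = 0
      · right; right; simp [hl0]
      obtain ⟨p, hp, -⟩ := exists_isMaxAt hc hi hr (smul_ne_zero hs hl0)
      have hlp : l = l (ξ p) • lam p := by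
        have h := hcrit _ _ hp
        rw [smul_apply, smul_eq_mul, mul_smul] at h
        exact smul_right_injective _ hs h
      obtain ⟨i, hpi⟩ := mem_iUnion.1 (hAc ▸ mem_univ p : p ∈ ⋃ i, A i)
      have hps := hAs i hpi
      have hsymm : (e i).symm (e i p) = p := (e i).left_inv hps
      have hz : (e i p, l (ξ p)) ∈ D i := by
        refine ⟨⟨(e i).map_source hps, ?_, ?_⟩, ?_, ?_⟩
        · simpa [hsymm] using hpi
        · simpa only [hsymm, ← hlp] using hl
        · intro h
          simp only at h
          rw [h, zero_smul] at hlp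
          exact hl0 hlp
        · simpa only [hsymm, ← hlp] using hp
      have himg : coneMap J lam (e i) (e i p, l (ξ p)) = J l := by
        simp only [coneMap, hsymm, ← hlp]
      by_cases hdet : (e i p, l (ξ p)) ∈ Z i
      · right; left
        exact mem_iUnion.2 ⟨i, _, ⟨hz, hdet⟩, himg⟩
      · left
        exact mem_iUnion.2 ⟨i, _, ⟨hz, hdet⟩, himg⟩
    have hnull : μ ((⋃ i, coneMap J lam (e i) '' (D i ∩ Z i)) ∪ {0}) = 0 := by
      refine measure_union_null (measure_iUnion_null fun i => ?_) (measure_singleton 0)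
      exact addHaar_image_eq_zero_of_det_fderivWithin_eq_zero μ (hder i _) fun z hz => hz.2
    calc μ (J '' G) ≤ _ := measure_mono hsub
      _ ≤ _ := measure_union_le _ _
      _ = _ := by rw [hnull, add_zero]

/-- Almost every covector is hit exactly twice by the cone map: at the point where it is maximal
and at the point where it is minimal. -/
theorem sum_lintegral_coneDomain (hlam : ∀ i, ContinuousOn lam (e i).source)
    (hA : ∀ i, MeasurableSet (A i)) (hAd : Pairwise (Function.onFun Disjoint A))
    (hAs : ∀ i, A i ⊆ (e i).source) (hAc : ⋃ i, A i = univ) (hG : IsOpen G)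
    (hd : ∀ i, ∀ z : Y × ℝ, z.1 ∈ (e i).target → DifferentiableAt ℝ (coneMap J lam (e i)) z)
    (ν : Measure Y) [ν.IsAddHaarMeasure] :
    ∑ i, ∫⁻ z in coneDomain lam (e i) (A i) G,
      ENNReal.ofReal |(fderiv ℝ (coneMap J lam (e i)) z).det| ∂(ν.prod volume) =
        2 * (ν.prod volume) (J '' G) := by
  -- The zero covector is maximal everywhere and would be counted for both signs; the slice `t = 0`
  -- is null and is left out.
  have hnull : (ν.prod (volume : Measure ℝ)) {z | z.2 = 0} = 0 := by
    have : {z : Y × ℝ | z.2 = 0} = univ ×ˢ {0} := by ext z; simp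
    rw [this, Measure.prod_prod]
    simp
  have hsplit : ∀ i, coneDomain lam (e i) (A i) G =ᵐ[ν.prod volume]
      (coneDomainMax f lam (e i) (A i) G 1 ∪ coneDomainMax f lam (e i) (A i) G (-1) :
        Set (Y × ℝ)) := by
    intro i
    have h0 : ∀ᵐ z ∂(ν.prod (volume : Measure ℝ)), z.2 ≠ 0 := by
      rw [ae_iff]; simpa using hnull
    filter_upwards [h0] with z hz
    refine propext ⟨fun h => ?_, fun h => h.elim (fun h => h.1) fun h => h.1⟩
    set p := (e i).symm z.1 with hp
    -- A supporting functional at `f p` is a nonzero multiple of `lam p`, so the sign of `z.2 / l (ξ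
    -- p)` decides whether `z.2 • lam p` or its negative is maximal at `p`.
    obtain ⟨l, hl0, hl⟩ := exists_supporting_functional hK hi (hr ▸ mem_range_self p)
    have hlp : IsMaxAt f l p := fun q =>
      hl _ (hc.isClosed.frontier_subset (hr ▸ mem_range_self q))
    have hlc := hcrit l p hlp
    have hc0 : l (ξ p) ≠ 0 := fun h => hl0 (by rw [hlc, h, zero_smul])
    have hsc : ∀ c : ℝ, 0 ≤ c → IsMaxAt f (c • l) p := fun c hc q =>
      mul_le_mul_of_nonneg_left (hlp q) hc
    have hlam' : lam p = (l (ξ p))⁻¹ • l := by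
      conv_rhs => rw [hlc]
      rw [smul_smul, smul_apply, smul_eq_mul, hone, mul_one, inv_mul_cancel₀ hc0, one_smul]
    rcases le_total 0 (z.2 * (l (ξ p))⁻¹) with hpos | hneg
    · left
      refine ⟨h, hz, ?_⟩
      rw [← hp, hlam', smul_smul, smul_smul, one_mul]
      exact hsc _ hpos
    · right
      refine ⟨h, hz, ?_⟩
      rw [← hp, hlam', smul_smul, smul_smul, neg_one_mul]
      exact hsc _ (by linarith)
  have hdisj : ∀ i, Disjoint (coneDomainMax f lam (e i) (A i) G 1)
      (coneDomainMax f lam (e i) (A i) G (-1)) := by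
    intro i
    refine Set.disjoint_left.2 fun z h1 h2 => ?_
    have hl0 : z.2 • lam ((e i).symm z.1) ≠ 0 := by
      intro h
      have := congrArg (fun L : V →L[ℝ] ℝ => L (ξ ((e i).symm z.1))) h
      simp [hone, h1.2.1] at this
    refine not_isMaxAt_neg hc hi hr hl0 (p := (e i).symm z.1) ?_ ?_
    · simpa only [one_smul] using h1.2.2
    · have hneg : ∀ l : V →L[ℝ] ℝ, (-1 : ℝ) • l = -l := fun l => by ext; simp
      simpa only [hneg] using h2.2.2
  have h2 : ∀ i, ∫⁻ z in coneDomain lam (e i) (A i) G,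
      ENNReal.ofReal |(fderiv ℝ (coneMap J lam (e i)) z).det| ∂(ν.prod volume) =
      ∫⁻ z in coneDomainMax f lam (e i) (A i) G 1,
        ENNReal.ofReal |(fderiv ℝ (coneMap J lam (e i)) z).det| ∂(ν.prod volume) +
      ∫⁻ z in coneDomainMax f lam (e i) (A i) G (-1),
        ENNReal.ofReal |(fderiv ℝ (coneMap J lam (e i)) z).det| ∂(ν.prod volume) := fun i => by
    rw [setLIntegral_congr (hsplit i), lintegral_union
      (measurableSet_coneDomainMax he.continuous (hlam i) (hA i) hG _) (hdisj i)]
  rw [Finset.sum_congr rfl fun i _ => h2 i, Finset.sum_add_distrib,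
    sum_lintegral_coneDomainMax hK hc hi hr he hξ hcrit hone hlam hA hAd hAs hAc hG hd _
      one_ne_zero,
    sum_lintegral_coneDomainMax hK hc hi hr he hξ hcrit hone hlam hA hAd hAs hAc hG hd _
      (neg_ne_zero.2 one_ne_zero), two_mul]

end AreaFormula

/-! ### Coordinates on `R^n × R` -/

/-- The standard basis of `R^n × R`. -/
def stdProdBasis (n : ℕ) : Module.Basis (Fin (n + 1)) ℝ (Rn n × ℝ) :=
  ((EuclideanSpace.basisFun (Fin n) ℝ).toBasis.prod
    (OrthonormalBasis.singleton (Fin 1) ℝ).toBasis).reindex finSumFinEquiv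

theorem stdProdBasis_castSucc {n : ℕ} (i : Fin n) :
    stdProdBasis n i.castSucc = (EuclideanSpace.basisFun (Fin n) ℝ i, 0) := by
  have : finSumFinEquiv.symm (i.castSucc : Fin (n + 1)) = (Sum.inl i : Fin n ⊕ Fin 1) :=
    finSumFinEquiv_symm_apply_castAdd i
  rw [stdProdBasis, Module.Basis.reindex_apply, this]
  simp [Module.Basis.prod_apply]

theorem stdProdBasis_last (n : ℕ) : stdProdBasis n (Fin.last n) = (0, 1) := by
  have : finSumFinEquiv.symm (Fin.last n : Fin (n + 1)) = (Sum.inr 0 : Fin n ⊕ Fin 1) :=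
    finSumFinEquiv_symm_apply_natAdd (0 : Fin 1)
  rw [stdProdBasis, Module.Basis.reindex_apply, this]
  simp [Module.Basis.prod_apply]

/-- The isomorphism of `R^{n+1}` with `R^n × R` that matches the standard bases. -/
def prodCoords (n : ℕ) : Rn (n + 1) ≃L[ℝ] Rn n × ℝ :=
  ((EuclideanSpace.basisFun (Fin (n + 1)) ℝ).toBasis.equiv (stdProdBasis n)
    (Equiv.refl _)).toContinuousLinearEquiv

theorem prodCoords_basisFun {n : ℕ} (i : Fin (n + 1)) :
    prodCoords n (EuclideanSpace.basisFun (Fin (n + 1)) ℝ i) = stdProdBasis n i := by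
  have := (EuclideanSpace.basisFun (Fin (n + 1)) ℝ).toBasis.equiv_apply (i := i)
    (b' := stdProdBasis n) (e := Equiv.refl _)
  rw [OrthonormalBasis.coe_toBasis] at this
  exact this

/-- Each side is the Haar measure normalized by a standard basis, and the map matches the bases. -/
theorem map_prodCoords (n : ℕ) :
    (volume : Measure (Rn (n + 1))).map (prodCoords n) =
      (volume : Measure (Rn n)).prod (volume : Measure ℝ) := by
  rw [← (EuclideanSpace.basisFun (Fin (n + 1)) ℝ).addHaar_eq_volume, Module.Basis.map_addHaar,
    ← (EuclideanSpace.basisFun (Fin n) ℝ).addHaar_eq_volume,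
    ← (OrthonormalBasis.singleton (Fin 1) ℝ).addHaar_eq_volume, ← Module.Basis.prod_addHaar]
  have : (EuclideanSpace.basisFun (Fin (n + 1)) ℝ).toBasis.map (prodCoords n).toLinearEquiv =
      stdProdBasis n := by
    refine Module.Basis.eq_of_apply_eq fun i => ?_
    rw [Module.Basis.map_apply, OrthonormalBasis.coe_toBasis]
    exact prodCoords_basisFun i
  rw [this, stdProdBasis, Module.Basis.addHaar_reindex]
  rfl

theorem volume_prodCoords_image {n : ℕ} (s : Set (Rn (n + 1))) :
    ((volume : Measure (Rn n)).prod (volume : Measure ℝ)) (prodCoords n '' s) = volume s := by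
  rw [← map_prodCoords]
  refine ((prodCoords n).toHomeomorph.measurableEmbedding.map_apply _ _).trans ?_
  exact congrArg _ (Set.preimage_image_eq s (prodCoords n).injective)

/-! ### The Jacobian determinant of the cone map -/

section Jacobian

variable {n : ℕ}

/-- Pairing covectors with a frame `v` turns the determinant of `A` into a quotient of determinants
of pairings. In the coordinates given by the ellipsoid the last factor has determinant ±Ω(v). -/
theorem toMatrix_mul_dual (Q : (Rn (n + 1) →L[ℝ] ℝ) ≃L[ℝ] Rn (n + 1))
    (A : (Rn n × ℝ) →L[ℝ] (Rn n × ℝ)) (v : Fin (n + 1) → Rn (n + 1)) :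
    (Matrix.of fun i j => (Q.trans (prodCoords n)).symm (A (stdProdBasis n i)) (v j)) =
      (LinearMap.toMatrix (stdProdBasis n) (stdProdBasis n) A.toLinearMap).transpose *
        Matrix.of fun i j => Q.symm (EuclideanSpace.basisFun (Fin (n + 1)) ℝ i) (v j) := by
  ext i j
  have h1 : A (stdProdBasis n i) = ∑ k, LinearMap.toMatrix (stdProdBasis n) (stdProdBasis n)
      A.toLinearMap k i • stdProdBasis n k := by
    conv_lhs => rw [← (stdProdBasis n).sum_repr (A (stdProdBasis n i))]
    simp [LinearMap.toMatrix_apply]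
  have h2 : ∀ k, (Q.trans (prodCoords n)).symm (stdProdBasis n k) =
      Q.symm (EuclideanSpace.basisFun (Fin (n + 1)) ℝ k) := fun k => by
    rw [← prodCoords_basisFun]
    simp [-EuclideanSpace.basisFun_apply]
  simp only [Matrix.of_apply, Matrix.mul_apply, Matrix.transpose_apply]
  rw [h1, map_sum, sum_apply]
  exact Finset.sum_congr rfl fun k _ => by rw [map_smul, h2]; rfl

theorem det_of_last_row (N : Matrix (Fin (n + 1)) (Fin (n + 1)) ℝ)
    (h0 : ∀ j : Fin n, N (Fin.last n) j.castSucc = 0) (h1 : N (Fin.last n) (Fin.last n) = 1) :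
    N.det = (Matrix.of fun i j : Fin n => N i.castSucc j.castSucc).det := by
  rw [Matrix.det_succ_row N (Fin.last n), Fin.sum_univ_castSucc]
  simp only [h0, h1, mul_zero, zero_mul, Finset.sum_const_zero, zero_add, Fin.val_last, mul_one,
    Even.neg_one_pow ⟨n, rfl⟩, one_mul, Fin.succAbove_last]
  rfl

/-- Pair the derivative of (y, t) ↦ t η(y) with the frame (∂₁u, …, ∂ₙu, w). The t-direction gives η,
that is, the row (0, …, 0, 1). The remaining block is t (∂ᵢη)(∂ⱼu) = -t η(∂ᵢ∂ⱼu), by differentiating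
η(∂ⱼu) = 0. -/
theorem abs_det_fderiv_cone {Ω : VolumeForm n} {Q : (Rn (n + 1) →L[ℝ] ℝ) ≃L[ℝ] Rn (n + 1)}
    (hQ : ∀ v : Fin (n + 1) → Rn (n + 1),
      |(Matrix.of fun i j => Q.symm (EuclideanSpace.basisFun (Fin (n + 1)) ℝ i) (v j)).det| =
        |Ω v|)
    {u : Rn n → Rn (n + 1)} {η : Rn n → Rn (n + 1) →L[ℝ] ℝ} {y : Rn n} {w : Rn (n + 1)}
    (hu : DifferentiableAt ℝ (fderiv ℝ u) y) (hη : DifferentiableAt ℝ η y)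
    (h0 : ∀ᶠ y' in 𝓝 y, ∀ h, η y' (fderiv ℝ u y' h) = 0) (h1 : η y w = 1) (t : ℝ) :
    |(fderiv ℝ (fun z : Rn n × ℝ => (Q.trans (prodCoords n)) (z.2 • η z.1)) (y, t)).det| *
      |Ω (Fin.snoc (fun i => fderiv ℝ u y (EuclideanSpace.basisFun (Fin n) ℝ i)) w)| =
    |t| ^ n * |(Matrix.of fun i j => η y (fderiv ℝ (fderiv ℝ u) y
      (EuclideanSpace.basisFun (Fin n) ℝ i) (EuclideanSpace.basisFun (Fin n) ℝ j))).det| := by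
  set b := EuclideanSpace.basisFun (Fin n) ℝ with hb
  set J := Q.trans (prodCoords n)
  set A := fderiv ℝ (fun z : Rn n × ℝ => J (z.2 • η z.1)) (y, t) with hA
  set v : Fin (n + 1) → Rn (n + 1) := Fin.snoc (fun i => fderiv ℝ u y (b i)) w with hv
  have hΨ : HasFDerivAt (fun z : Rn n × ℝ => z.2 • η z.1)
      (t • (fderiv ℝ η y).comp (ContinuousLinearMap.fst ℝ (Rn n) ℝ) +
        (ContinuousLinearMap.snd ℝ (Rn n) ℝ).smulRight (η y)) (y, t) := by
    have h : HasFDerivAt (fun z : Rn n × ℝ => η z.1)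
        ((fderiv ℝ η y).comp (ContinuousLinearMap.fst ℝ (Rn n) ℝ)) (y, t) :=
      HasFDerivAt.comp (y, t) (g := η) (f := Prod.fst) hη.hasFDerivAt hasFDerivAt_fst
    exact HasFDerivAt.fun_smul (c := Prod.snd) hasFDerivAt_snd h
  have hA' : ∀ h : Rn n × ℝ, J.symm (A h) = t • fderiv ℝ η y h.1 + h.2 • η y := fun h => by
    have := (J.toContinuousLinearMap.hasFDerivAt.comp (y, t) hΨ).fderiv
    have hA'' : A = J.toContinuousLinearMap.comp
      (t • (fderiv ℝ η y).comp (ContinuousLinearMap.fst ℝ (Rn n) ℝ) +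
        (ContinuousLinearMap.snd ℝ (Rn n) ℝ).smulRight (η y)) := this
    rw [hA'', ContinuousLinearMap.comp_apply]
    exact J.symm_apply_apply _
  have hη' : ∀ h k, fderiv ℝ η y h (fderiv ℝ u y k) = -η y (fderiv ℝ (fderiv ℝ u) y h k) := by
    intro h k
    have hd := hη.hasFDerivAt.clm_apply
      (hu.hasFDerivAt.clm_apply (hasFDerivAt_const k y))
    have hz : (fun y' => η y' (fderiv ℝ u y' k)) =ᶠ[𝓝 y] fun _ => 0 := by
      filter_upwards [h0] with y' hy' using hy' k
    have h2 := hd.unique ((hasFDerivAt_const (0 : ℝ) y).congr_of_eventuallyEq hz)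
    have h3 := congrArg (fun L : Rn n →L[ℝ] ℝ => L h) h2
    simp at h3
    linarith
  have hdet := congrArg (fun N : Matrix _ _ ℝ => |N.det|) (toMatrix_mul_dual Q A v)
  simp only [Matrix.det_mul, abs_mul, hQ, Matrix.det_transpose] at hdet
  rw [LinearMap.det_toMatrix] at hdet
  refine hdet.symm.trans ?_
  have hN : ∀ i j, (Matrix.of fun i j => J.symm (A (stdProdBasis n i)) (v j)) i j =
      (t • fderiv ℝ η y (stdProdBasis n i).1 + (stdProdBasis n i).2 • η y) (v j) := fun i j => by
    rw [Matrix.of_apply, hA']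
  have hy0 := h0.self_of_nhds
  rw [det_of_last_row]
  · have : (Matrix.of fun i j : Fin n => (Matrix.of fun i j =>
        J.symm (A (stdProdBasis n i)) (v j)) i.castSucc j.castSucc) =
        (-t) • Matrix.of fun i j => η y (fderiv ℝ (fderiv ℝ u) y (b i) (b j)) := by
      ext i j
      rw [Matrix.of_apply, hN, stdProdBasis_castSucc]
      simp [hv, hη', ← hb]
    rw [this, Matrix.det_smul, abs_mul, abs_pow, abs_neg, Fintype.card_fin]
  · intro j
    rw [hN, stdProdBasis_last]
    simp [hv, hy0]
  · rw [hN, stdProdBasis_last]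
    simp [hv, h1]

end Jacobian

/-- The right side is the sum of |t|^n |t| over t = ±r. This trades a sum over a fibre of the
ellipsoid bundle for an integral along the line. -/
theorem lintegral_ball_abs_pow (n : ℕ) {r : ℝ} (hr : 0 ≤ r) :
    ((n : ENNReal) + 1) * ∫⁻ t in {t : ℝ | |t| < r}, ENNReal.ofReal (|t| ^ n) =
      ENNReal.ofReal (2 * r ^ (n + 1)) := by
  have hset : {t : ℝ | |t| < r} = Set.Ioo (-r) r := by
    ext t; simp [abs_lt]
  have hcont : Continuous fun t : ℝ => |t| ^ n := by fun_prop
  have hint : ∫ t in (-r)..r, |t| ^ n = 2 * r ^ (n + 1) / (n + 1) := by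
    have hpos : ∫ t in (0 : ℝ)..r, |t| ^ n = r ^ (n + 1) / (n + 1) := by
      rw [intervalIntegral.integral_congr (g := fun t => t ^ n)]
      · simp
      · intro t ht
        rw [Set.uIcc_of_le hr] at ht
        simp [abs_of_nonneg ht.1]
    have hneg : ∫ t in (-r)..0, |t| ^ n = r ^ (n + 1) / (n + 1) := by
      rw [← hpos]
      have := intervalIntegral.integral_comp_neg (a := 0) (b := r) fun t : ℝ => |t| ^ n
      simpa using this.symm
    rw [← intervalIntegral.integral_add_adjacent_intervals (hcont.intervalIntegrable _ 0)
      (hcont.intervalIntegrable 0 _), hpos, hneg]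
    ring
  rw [hset, setLIntegral_congr Ioo_ae_eq_Ioc, ← ofReal_integral_eq_lintegral_ofReal,
    ← intervalIntegral.integral_of_le (by linarith), hint]
  · have : ((n : ENNReal) + 1) = ENNReal.ofReal (n + 1) := by
      rw [ENNReal.ofReal_add (by positivity) zero_le_one]; simp
    rw [this, ← ENNReal.ofReal_mul (by positivity)]
    congr 1
    field_simp
  · exact (intervalIntegrable_iff_integrableOn_Ioc_of_le (by linarith)).1
      (hcont.intervalIntegrable _ _)
  · exact Filter.Eventually.of_forall fun t => by positivity

/-! ### The conormal and the affine fundamental form in charts -/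

section Charts

open Set Filter

variable {n : ℕ} {M : Type*} [TopologicalSpace M] [ChartedSpace (Rn n) M]

/-- The conormal covector of `(f, ξ)` at `p`: it vanishes on `df (T_p M)` and is `1` on `ξ_p`. -/
def conormal (Ω : VolumeForm n) (f ξ : M → Rn (n + 1)) (p : M) : Rn (n + 1) →L[ℝ] ℝ :=
  LinearMap.toContinuousLinearMap
    ((Ω (Fin.snoc (fun i => dmap f p (stdFrame p i)) (ξ p)))⁻¹ •
      Ω.toMultilinearMap.toLinearMap (Fin.snoc (fun i => dmap f p (stdFrame p i)) 0) (Fin.last n))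

theorem conormal_apply (Ω : VolumeForm n) (f ξ : M → Rn (n + 1)) (p : M) (w : Rn (n + 1)) :
    conormal Ω f ξ p w = transCoord Ω f ξ p w := by
  change (Ω (Fin.snoc (fun i => dmap f p (stdFrame p i)) (ξ p)))⁻¹ *
    Ω (Function.update (Fin.snoc (fun i => dmap f p (stdFrame p i)) 0) (Fin.last n) w) = _
  rw [show Function.update (Fin.snoc (fun i => dmap f p (stdFrame p i)) 0 :
    Fin (n + 1) → Rn (n + 1)) (Fin.last n) w = Fin.snoc (fun i => dmap f p (stdFrame p i)) w from
    Fin.update_snoc_last (α := fun _ => Rn (n + 1)) .., transCoord, div_eq_inv_mul]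

theorem apply_stdFrame_ne_zero {p : M} {g : TangentSpace (𝓡 n) p [⋀^Fin n]→ₗ[ℝ] ℝ} (hg : g ≠ 0) :
    g (stdFrame p) ≠ 0 := fun h => hg <| by
  ext X
  rw [map_eq_det_smul (stdBasis p) g X, coe_stdBasis, h, smul_zero]
  rfl

/-- A change of frame multiplies a Gram determinant by the square of its determinant; no
normalization or independence of `X` is needed. -/
theorem detVol_mul_sq (θ : ∀ p : M, TangentSpace (𝓡 n) p [⋀^Fin n]→ₗ[ℝ] ℝ) {p : M}
    (hθ : θ p ≠ 0) (b : LinearMap.BilinForm ℝ (TangentSpace (𝓡 n) p))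
    (X : Fin n → TangentSpace (𝓡 n) p) :
    detVol θ p (fun u v => b u v) * θ p X ^ 2 = (Matrix.of fun i j => b (X i) (X j)).det := by
  have h0 := apply_stdFrame_ne_zero hθ
  have h1 := map_eq_det_smul (stdBasis p) (θ p) X
  rw [smul_eq_mul, coe_stdBasis] at h1
  have hd : (Matrix.of fun i j => b (X i) (X j)) = ((stdBasis p).toMatrix X).transpose *
      (Matrix.of fun i j => b (stdFrame p i) (stdFrame p j)) * (stdBasis p).toMatrix X := by
    ext i j
    have hi : ∀ i, X i = ∑ k, (stdBasis p).toMatrix X k i • stdFrame p k := fun i => by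
      rw [← coe_stdBasis]
      exact ((stdBasis p).sum_toMatrix_smul_self X i).symm
    simp only [Matrix.mul_apply, Matrix.of_apply, Matrix.transpose_apply]
    conv_lhs => rw [hi i, hi j]
    simp only [map_sum, map_smul, LinearMap.sum_apply, LinearMap.smul_apply, smul_eq_mul,
      Finset.mul_sum, Finset.sum_mul]
    refine Finset.sum_congr rfl fun k _ => Finset.sum_congr rfl fun l _ => by ring
  rw [hd, Matrix.det_mul, Matrix.det_mul, Matrix.det_transpose, ← Module.Basis.det_apply, detVol,
    h1]
  field_simp

variable [IsManifold (𝓡 n) ∞ M]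

section Chart

variable {E : Type*} [NormedAddCommGroup E] [NormedSpace ℝ E]

theorem contDiffOn_comp_symm {g : M → E} (hg : ContMDiff (𝓡 n) 𝓘(ℝ, E) ∞ g) (x : M) :
    ContDiffOn ℝ ∞ (g ∘ (chartAt (Rn n) x).symm) (chartAt (Rn n) x).target :=
  contMDiffOn_iff_contDiffOn.1 (hg.comp_contMDiffOn contMDiffOn_chart_symm)

theorem mfderiv_eq_fderiv_chart {g : M → E} {p x : M} (hp : p ∈ (chartAt (Rn n) x).source)
    (hg : DifferentiableAt ℝ (g ∘ (chartAt (Rn n) x).symm) (chartAt (Rn n) x p))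
    (v : TangentSpace (𝓡 n) p) :
    (mfderiv (𝓡 n) 𝓘(ℝ, E) g p v : E) = fderiv ℝ (g ∘ (chartAt (Rn n) x).symm) (chartAt (Rn n) x p)
      (mfderiv (𝓡 n) (𝓡 n) (chartAt (Rn n) x) p v : Rn n) := by
  have h1 := (mdifferentiableAt_atlas (I := 𝓡 n) (chart_mem_atlas (Rn n) x) hp).hasMFDerivAt
  have h2 := hg.hasFDerivAt.hasMFDerivAt
  have h3 := (h2.comp p h1).congr_of_eventuallyEq (f₁ := g) (by
    filter_upwards [(chartAt (Rn n) x).open_source.mem_nhds hp] with q hq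
    simp [(chartAt (Rn n) x).left_inv hq])
  rw [h3.mfderiv]
  rfl

theorem mfderiv_chart_symm_apply {x : M} {y : Rn n} (hy : y ∈ (chartAt (Rn n) x).target) (w : Rn n) :
    (mfderiv (𝓡 n) (𝓡 n) (chartAt (Rn n) x) ((chartAt (Rn n) x).symm y)
      (mfderiv (𝓡 n) (𝓡 n) (chartAt (Rn n) x).symm y w) : Rn n) = w := by
  have := (mdifferentiable_chart (I := 𝓡 n) x).comp_symm_deriv hy
  exact congrArg (fun L : Rn n →L[ℝ] Rn n => L w) this

/-- On the chart domain the differential of the chart is the fibre coordinate of the tangent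
bundle's trivialization. -/
theorem mdifferentiableAt_mfderiv_chart_section {x p : M} (hp : p ∈ (chartAt (Rn n) x).source)
    {Y : ∀ q : M, TangentSpace (𝓡 n) q}
    (hY : MDifferentiableAt (𝓡 n) (𝓡 n).tangent
      (fun q => (⟨q, Y q⟩ : TangentBundle (𝓡 n) M)) p) :
    MDifferentiableAt (𝓡 n) 𝓘(ℝ, Rn n)
      (fun q => (mfderiv (𝓡 n) (𝓡 n) (chartAt (Rn n) x) q (Y q) : Rn n)) p := by
  have hb : p ∈ (trivializationAt (Rn n) (TangentSpace (𝓡 n) : M → Type _) x).baseSet := by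
    simpa using hp
  have h := ((trivializationAt (Rn n) (TangentSpace (𝓡 n) : M → Type _) x).mdifferentiableAt_section_iff
    (𝓡 n) Y hb).1 hY
  refine h.congr_of_eventuallyEq ?_
  filter_upwards [(chartAt (Rn n) x).open_source.mem_nhds hp] with q hq
  have hq' : q ∈ (trivializationAt (Rn n) (TangentSpace (𝓡 n) : M → Type _) x).baseSet := by
    simpa using hq
  have h2 := congrArg (fun L : TangentSpace (𝓡 n) q →L[ℝ] Rn n => L (Y q))
    (TangentBundle.continuousLinearMapAt_trivializationAt (I := 𝓡 n) hq)
  refine Eq.trans h2.symm ?_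
  change (trivializationAt (Rn n) (TangentSpace (𝓡 n) : M → Type _) x).linearMapAt ℝ q (Y q) = _
  rw [Bundle.Trivialization.coe_linearMapAt_of_mem _ hq']

end Chart

variable {Ω : VolumeForm n} {θ : ∀ p : M, TangentSpace (𝓡 n) p [⋀^Fin n]→ₗ[ℝ] ℝ}
  {cov : CovariantDerivative (𝓡 n) (Rn n) (TangentSpace (𝓡 n) : M → Type _)}
  {f ξ : M → Rn (n + 1)}

theorem dmap_eq_fderiv_chart (hf : ContMDiff (𝓡 n) 𝓘(ℝ, Rn (n + 1)) ∞ f) {p x : M}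
    (hp : p ∈ (chartAt (Rn n) x).source) (v : TangentSpace (𝓡 n) p) :
    dmap f p v = fderiv ℝ (f ∘ (chartAt (Rn n) x).symm) (chartAt (Rn n) x p)
      (mfderiv (𝓡 n) (𝓡 n) (chartAt (Rn n) x) p v : Rn n) :=
  mfderiv_eq_fderiv_chart hp (((contDiffOn_comp_symm hf x).contDiffAt
    ((chartAt (Rn n) x).open_target.mem_nhds ((chartAt (Rn n) x).map_source hp))).differentiableAt
      (by simp)) v

theorem dmap_mfderiv_symm (hf : ContMDiff (𝓡 n) 𝓘(ℝ, Rn (n + 1)) ∞ f) {x : M} {y : Rn n}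
    (hy : y ∈ (chartAt (Rn n) x).target) (w : Rn n) :
    dmap f ((chartAt (Rn n) x).symm y) (mfderiv (𝓡 n) (𝓡 n) (chartAt (Rn n) x).symm y w) =
      fderiv ℝ (f ∘ (chartAt (Rn n) x).symm) y w := by
  rw [dmap_eq_fderiv_chart hf ((chartAt (Rn n) x).map_target hy), mfderiv_chart_symm_apply hy,
    (chartAt (Rn n) x).right_inv hy]

namespace IsEquiaffineImmersion

variable (hf : IsEquiaffineImmersion Ω cov θ f ξ) (hθ : ∀ p, θ p ≠ 0)
include hf hθ

theorem conormal_dmap_add (p : M) (v : TangentSpace (𝓡 n) p) (a : ℝ) :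
    conormal Ω f ξ p (dmap f p v + a • ξ p) = a := by
  rw [conormal_apply]
  refine transCoord_eq Ω f ξ p ?_ v a
  rw [← hf.volume]
  exact apply_stdFrame_ne_zero (hθ p)

theorem conormal_dmap (p : M) (v : TangentSpace (𝓡 n) p) : conormal Ω f ξ p (dmap f p v) = 0 := by
  simpa using hf.conormal_dmap_add hθ p v 0

theorem conormal_field (p : M) : conormal Ω f ξ p (ξ p) = 1 := by
  simpa using hf.conormal_dmap_add hθ p 0 1

omit hθ in
theorem exists_decomp (p : M) (w : Rn (n + 1)) :
    ∃ (v : TangentSpace (𝓡 n) p) (a : ℝ), w = dmap f p v + a • ξ p := by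
  have hw : w ∈ LinearMap.range (dmap f p) ⊔ Submodule.span ℝ {ξ p} := by
    rw [(hf.transversal p).sup_eq_top]; trivial
  obtain ⟨_, ⟨v, rfl⟩, z, hz, rfl⟩ := Submodule.mem_sup.1 hw
  obtain ⟨a, rfl⟩ := Submodule.mem_span_singleton.1 hz
  exact ⟨v, a, rfl⟩

theorem eq_smul_conormal (p : M) (l : Rn (n + 1) →L[ℝ] ℝ) (hl : ∀ v, l (dmap f p v) = 0) :
    l = l (ξ p) • conormal Ω f ξ p := by
  ext w
  obtain ⟨v, a, rfl⟩ := hf.exists_decomp p w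
  rw [map_add, hl, smul_apply, hf.conormal_dmap_add hθ]
  simp [mul_comm]

/-- The tangential part of `w` contributes nothing, because `n + 1` vectors of `T_p M` are
dependent; the rest is the volume condition on `ξ`. -/
theorem volume_snoc (p : M) (X : Fin n → TangentSpace (𝓡 n) p) (w : Rn (n + 1)) :
    Ω (Fin.snoc (fun i => dmap f p (X i)) w) = conormal Ω f ξ p w * θ p X := by
  obtain ⟨v, a, rfl⟩ := hf.exists_decomp p w
  have hu : ∀ y : Rn (n + 1),
      (Fin.snoc (fun i => dmap f p (X i)) y : Fin (n + 1) → Rn (n + 1)) =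
      Function.update (Fin.snoc (fun i => dmap f p (X i)) 0 : Fin (n + 1) → Rn (n + 1))
        (Fin.last n) y :=
    fun y => (Fin.update_snoc_last (α := fun _ => Rn (n + 1)) ..).symm
  have h0 : Ω (Fin.snoc (fun i => dmap f p (X i)) (dmap f p v)) = 0 := by
    refine AlternatingMap.map_linearDependent Ω _ fun hl => ?_
    have hcomp : (Fin.snoc (fun i => dmap f p (X i)) (dmap f p v) : Fin (n + 1) → Rn (n + 1)) =
        dmap f p ∘ (Fin.snoc X v : Fin (n + 1) → TangentSpace (𝓡 n) p) :=
      (Fin.comp_snoc (dmap f p) X v).symm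
    rw [hcomp] at hl
    have : Module.Finite ℝ (TangentSpace (𝓡 n) p) := inferInstanceAs (Module.Finite ℝ (Rn n))
    have h := (LinearIndependent.of_comp _ hl).fintype_card_le_finrank
    have hfin : Module.finrank ℝ (TangentSpace (𝓡 n) p) = n :=
      finrank_euclideanSpace_fin (𝕜 := ℝ)
    rw [hfin, Fintype.card_fin] at h
    omega
  rw [hf.conormal_dmap_add hθ, hu, AlternatingMap.map_update_add, AlternatingMap.map_update_smul,
    ← hu, ← hu, h0, zero_add, smul_eq_mul, ← hf.volume]

/-- The factor `(θ p (stdFrame p))⁻¹` in `nuTilde` cancels the one from `volume_snoc`. This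
identifies the Gauss map with the cone map. -/
theorem height_nuTilde (p : M) (t : ℝ) (w : Rn (n + 1)) :
    height Ω (nuTilde θ f p t) w = t * conormal Ω f ξ p w := by
  have h0 := apply_stdFrame_ne_zero (hθ p)
  rw [← heightDual_apply, nuTilde, map_smul, map_smul, smul_apply, smul_apply, heightDual_apply,
    height_wedge, hf.volume_snoc hθ]
  simp only [smul_eq_mul]
  field_simp

theorem heightDual_nuTilde (p : M) (t : ℝ) :
    heightDual Ω (nuTilde θ f p t) = t • conormal Ω f ξ p := by
  ext w
  exact hf.height_nuTilde hθ p t w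

theorem abs_lipschitzKilling (p : M) (t : ℝ) :
    |lipschitzKilling Ω θ f ξ (p, t)| = |t| ^ n * |detVol θ p (affForm Ω f ξ p)| := by
  rw [lipschitzKilling, abs_mul, abs_pow, abs_neg, abs_one, one_pow, one_mul]
  have : ∀ u v, height Ω (nuTilde θ f p t) (affForm Ω f ξ p u v • ξ p) =
      t * affForm Ω f ξ p u v := by
    intro u v
    rw [hf.height_nuTilde hθ, map_smul, hf.conormal_field hθ, smul_eq_mul, mul_one]
  simp only [detVol, this]
  have hM : (Matrix.of fun i j => t * affForm Ω f ξ p (stdFrame p i) (stdFrame p j)) =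
      t • Matrix.of fun i j => affForm Ω f ξ p (stdFrame p i) (stdFrame p j) := by
    ext i j; simp
  rw [hM, Matrix.det_smul, Fintype.card_fin, mul_div_assoc, abs_mul, abs_pow]

/-- With `W` the coordinates of an extension of `v'`, the product rule gives D²u(v, W) + du(DW(v)).
The second term is tangent and the conormal kills it, so the choice of extension does not matter. -/
theorem affForm_eq_chart {p x : M} (hp : p ∈ (chartAt (Rn n) x).source)
    (v v' : TangentSpace (𝓡 n) p) :
    affForm Ω f ξ p v v' = conormal Ω f ξ p
      (fderiv ℝ (fderiv ℝ (f ∘ (chartAt (Rn n) x).symm)) (chartAt (Rn n) x p)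
        (mfderiv (𝓡 n) (𝓡 n) (chartAt (Rn n) x) p v : Rn n)
        (mfderiv (𝓡 n) (𝓡 n) (chartAt (Rn n) x) p v' : Rn n)) := by
  set e := chartAt (Rn n) x with he
  set u := f ∘ e.symm with hu
  have hy : e p ∈ e.target := e.map_source hp
  have hu2 : ContDiffAt ℝ ∞ u (e p) :=
    (contDiffOn_comp_symm hf.smooth x).contDiffAt (e.open_target.mem_nhds hy)
  have hdu : DifferentiableAt ℝ (fderiv ℝ u) (e p) :=
    (hu2.fderiv_right (m := 1) (by norm_cast)).differentiableAt one_ne_zero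
  let Y : ∀ q : M, TangentSpace (𝓡 n) q := FiberBundle.extend (Rn n) v'
  let W : M → Rn n := fun q => mfderiv (𝓡 n) (𝓡 n) e q (Y q)
  have hW : DifferentiableAt ℝ (W ∘ e.symm) (e p) := by
    rw [← mdifferentiableAt_iff_differentiableAt]
    refine MDifferentiableAt.comp (e p) (I' := 𝓡 n) ?_
      (mdifferentiableAt_atlas_symm (chart_mem_atlas (Rn n) x) hy)
    rw [e.left_inv hp]
    exact mdifferentiableAt_mfderiv_chart_section hp (FiberBundle.mdifferentiableAt_extend (𝓡 n) (Rn n) v')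
  let g : M → Rn (n + 1) := fun q => dmap f q (Y q)
  have hg : (g ∘ e.symm) =ᶠ[𝓝 (e p)] fun z => fderiv ℝ u z ((W ∘ e.symm) z) := by
    filter_upwards [e.open_target.mem_nhds hy] with z hz
    have := dmap_eq_fderiv_chart hf.smooth (e.map_target hz) (Y (e.symm z))
    rw [e.right_inv hz] at this
    exact this
  have hder := (hdu.hasFDerivAt.clm_apply hW.hasFDerivAt).congr_of_eventuallyEq hg
  have hflat : flatDeriv f Y p v = fderiv ℝ (g ∘ e.symm) (e p)
      (mfderiv (𝓡 n) (𝓡 n) e p v : Rn n) :=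
    mfderiv_eq_fderiv_chart hp hder.differentiableAt v
  have hWp : (W ∘ e.symm) (e p) = (mfderiv (𝓡 n) (𝓡 n) e p v' : Rn n) := by
    have h : (W ∘ e.symm) (e p) = W p := congrArg W (e.left_inv hp)
    exact h.trans (congrArg (mfderiv (𝓡 n) (𝓡 n) e p) (FiberBundle.extend_apply_self (Rn n) v'))
  have hker : ∀ w : Rn n, conormal Ω f ξ p (fderiv ℝ u (e p) w) = 0 := by
    intro w
    have h := dmap_mfderiv_symm hf.smooth hy w
    rw [← h]
    -- The tangent space depends on the point, so `e.symm (e p)` is replaced by `p` through a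
    -- general `q`.
    have : ∀ q, q = p → ∀ v : TangentSpace (𝓡 n) q, conormal Ω f ξ p (dmap f q v) = 0 := by
      rintro q rfl v
      exact hf.conormal_dmap hθ q v
    exact this _ (e.left_inv hp) _
  rw [affForm, ← conormal_apply, hflat, hder.fderiv, ← hWp]
  change conormal Ω f ξ p (fderiv ℝ u (e p) (fderiv ℝ (W ∘ e.symm) (e p) _) + _) = _
  rw [map_add, hker, zero_add]
  rfl

/-- At a maximum the differential of `l ∘ f` vanishes, so `l` kills the tangent space. -/
theorem eq_smul_of_isMaxAt {l : Rn (n + 1) →L[ℝ] ℝ} {p : M} (hp : IsMaxAt f l p) :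
    l = l (ξ p) • conormal Ω f ξ p := by
  refine hf.eq_smul_conormal hθ p l fun v => ?_
  have hps := mem_chart_source (Rn n) p
  rw [dmap_eq_fderiv_chart hf.smooth hps]
  set e := chartAt (Rn n) p
  have hd : DifferentiableAt ℝ (f ∘ e.symm) (e p) := ((contDiffOn_comp_symm hf.smooth p).contDiffAt
    (e.open_target.mem_nhds (e.map_source hps))).differentiableAt (by simp)
  have hmax : IsLocalMax (fun y => l ((f ∘ e.symm) y)) (e p) := by
    refine Filter.Eventually.of_forall fun y => ?_
    simp only [Function.comp_apply, e.left_inv hps]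
    exact hp _
  have h0 := hmax.hasFDerivAt_eq_zero (l.hasFDerivAt.comp (e p) hd.hasFDerivAt)
  exact congrArg (fun L : Rn n →L[ℝ] ℝ => L _) h0

omit hθ in
/-- The volume density in a chart. -/
theorem volume_chart {x : M} {y : Rn n} (hy : y ∈ (chartAt (Rn n) x).target) :
    θ ((chartAt (Rn n) x).symm y) (fun i => mfderiv (𝓡 n) (𝓡 n) (chartAt (Rn n) x).symm y
      (EuclideanSpace.basisFun (Fin n) ℝ i : Rn n)) =
    Ω (Fin.snoc (fun i => fderiv ℝ (f ∘ (chartAt (Rn n) x).symm) y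
      (EuclideanSpace.basisFun (Fin n) ℝ i)) (ξ ((chartAt (Rn n) x).symm y))) := by
  rw [hf.volume]
  simp_rw [dmap_mfderiv_symm hf.smooth hy]

end IsEquiaffineImmersion

end Charts

/-! ### Smoothness and the Jacobian of the cone map over a chart -/

theorem contDiff_volumeForm {n : ℕ} (Ω : VolumeForm n) :
    ContDiff ℝ ∞ (fun v : Fin (n + 1) → Rn (n + 1) => Ω v) := by
  have h : (fun v : Fin (n + 1) → Rn (n + 1) => Ω v) = fun v =>
      (Matrix.of fun i j => v j i).det * Ω (EuclideanSpace.basisFun (Fin (n + 1)) ℝ) := by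
    ext v
    rw [map_eq_det_smul (EuclideanSpace.basisFun (Fin (n + 1)) ℝ).toBasis Ω v, smul_eq_mul,
      OrthonormalBasis.coe_toBasis, Module.Basis.det_apply]
    congr 2
  rw [h]
  simp only [Matrix.det_apply, Matrix.of_apply]
  refine ContDiff.mul (ContDiff.sum fun σ _ => ?_) contDiff_const
  refine ContDiff.const_smul _ (contDiff_prod fun i _ => ?_)
  fun_prop

/-- Change of frame in the volume form. -/
theorem volume_snoc_comp {n : ℕ} (Ω : VolumeForm n) (L : Rn n →ₗ[ℝ] Rn (n + 1))
    (T : Rn n →ₗ[ℝ] Rn n) (w : Rn (n + 1)) :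
    Ω (Fin.snoc (fun i => L (T (EuclideanSpace.basisFun (Fin n) ℝ i))) w) =
      LinearMap.det T * Ω (Fin.snoc (fun i => L (EuclideanSpace.basisFun (Fin n) ℝ i)) w) := by
  let g : Rn n [⋀^Fin n]→ₗ[ℝ] ℝ := ((-1 : ℝ) ^ n • Ω.curryLeft w).compLinearMap L
  have hg : ∀ v : Fin n → Rn n, g v = Ω (Fin.snoc (fun i => L (v i)) w) := fun v => by
    rw [← height_wedge, height, exteriorPower.alternatingMapLinearEquiv_apply_ιMulti]
    rfl
  have h := map_eq_det_smul (EuclideanSpace.basisFun (Fin n) ℝ).toBasis g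
    (T ∘ (EuclideanSpace.basisFun (Fin n) ℝ).toBasis)
  rw [Module.Basis.det_comp_basis, hg, hg] at h
  simpa only [OrthonormalBasis.coe_toBasis, Function.comp_apply, smul_eq_mul,
    Module.Basis.equiv_refl, LinearEquiv.refl_toLinearMap, LinearMap.comp_id] using h

section Charts

open Set Filter

variable {n : ℕ} {M : Type*} [TopologicalSpace M] [ChartedSpace (Rn n) M]

/-- The density of `|θ|` in the chart at `x`, in terms of the immersion. -/
def volDensity (Ω : VolumeForm n) (f ξ : M → Rn (n + 1)) (x : M) (y : Rn n) : ℝ :=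
  |Ω (Fin.snoc (fun i => fderiv ℝ (f ∘ (chartAt (Rn n) x).symm) y
    (EuclideanSpace.basisFun (Fin n) ℝ i)) (ξ ((chartAt (Rn n) x).symm y)))|

variable [IsManifold (𝓡 n) ∞ M]
  {Ω : VolumeForm n} {θ : ∀ p : M, TangentSpace (𝓡 n) p [⋀^Fin n]→ₗ[ℝ] ℝ}
  {cov : CovariantDerivative (𝓡 n) (Rn n) (TangentSpace (𝓡 n) : M → Type _)}
  {f ξ : M → Rn (n + 1)}

theorem apply_chartFrame_ne_zero {x : M} {y : Rn n} (hy : y ∈ (chartAt (Rn n) x).target)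
    {g : TangentSpace (𝓡 n) ((chartAt (Rn n) x).symm y) [⋀^Fin n]→ₗ[ℝ] ℝ} (hg : g ≠ 0) :
    g (fun i => mfderiv (𝓡 n) (𝓡 n) (chartAt (Rn n) x).symm y
      (EuclideanSpace.basisFun (Fin n) ℝ i : Rn n)) ≠ 0 := fun h => hg <| by
  let b : Module.Basis (Fin n) ℝ (TangentSpace (𝓡 n) ((chartAt (Rn n) x).symm y)) :=
    (EuclideanSpace.basisFun (Fin n) ℝ).toBasis.map
      ((mdifferentiable_chart (I := 𝓡 n) x).symm.mfderiv hy).toLinearEquiv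
  have hb : ⇑b = fun i => mfderiv (𝓡 n) (𝓡 n) (chartAt (Rn n) x).symm y
      (EuclideanSpace.basisFun (Fin n) ℝ i : Rn n) := by
    ext1 i
    refine (Module.Basis.map_apply _ _ i).trans ?_
    exact congrArg ((mdifferentiable_chart (I := 𝓡 n) x).symm.mfderiv hy)
      (congrFun (EuclideanSpace.basisFun (Fin n) ℝ).coe_toBasis i)
  ext X
  rw [map_eq_det_smul b g X, hb, h, smul_zero]
  rfl

namespace IsEquiaffineImmersion

variable (hf : IsEquiaffineImmersion Ω cov θ f ξ) (hθ : ∀ p, θ p ≠ 0)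
include hf

theorem contDiffOn_volume_snoc (x : M) {w : Rn n → Rn (n + 1)}
    (hw : ContDiffOn ℝ ∞ w (chartAt (Rn n) x).target) :
    ContDiffOn ℝ ∞ (fun y => Ω (Fin.snoc (fun i => fderiv ℝ (f ∘ (chartAt (Rn n) x).symm) y
      (EuclideanSpace.basisFun (Fin n) ℝ i)) (w y))) (chartAt (Rn n) x).target := by
  refine (contDiff_volumeForm Ω).comp_contDiffOn (contDiffOn_pi.2 fun i => ?_)
  refine Fin.lastCases ?_ (fun i => ?_) i
  · simpa using hw
  · simp only [Fin.snoc_castSucc]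
    exact ((contDiffOn_comp_symm hf.smooth x).fderiv_of_isOpen (chartAt (Rn n) x).open_target
      (by simp)).clm_apply contDiffOn_const

theorem continuousOn_volDensity (x : M) :
    ContinuousOn (volDensity Ω f ξ x) (chartAt (Rn n) x).target :=
  (hf.contDiffOn_volume_snoc x (contDiffOn_comp_symm hf.smooth_field x)).continuousOn.abs

include hθ

theorem volDensity_pos {x : M} {y : Rn n} (hy : y ∈ (chartAt (Rn n) x).target) :
    0 < volDensity Ω f ξ x y := by
  rw [volDensity, ← hf.volume_chart hy]
  exact abs_pos.2 (apply_chartFrame_ne_zero hy (hθ _))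

/-- By Cramer's rule the value on `w` is Ω(∂u, w) / Ω(∂u, ξ), a quotient of smooth functions with
nonzero denominator. -/
theorem contDiffOn_conormal (x : M) :
    ContDiffOn ℝ ∞ (conormal Ω f ξ ∘ (chartAt (Rn n) x).symm) (chartAt (Rn n) x).target := by
  refine contDiffOn_clm_apply.2 fun w => ?_
  refine ((hf.contDiffOn_volume_snoc x (contDiffOn_const (c := w))).div
    (hf.contDiffOn_volume_snoc x (contDiffOn_comp_symm hf.smooth_field x)) ?_).congr ?_
  · intro y hy
    exact abs_pos.1 (hf.volDensity_pos hθ hy)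
  · intro y hy
    have h0 := abs_pos.1 (hf.volDensity_pos hθ hy)
    have h := hf.volume_snoc hθ _ (fun i => mfderiv (𝓡 n) (𝓡 n) (chartAt (Rn n) x).symm y
      (EuclideanSpace.basisFun (Fin n) ℝ i : Rn n)) w
    simp_rw [dmap_mfderiv_symm hf.smooth hy] at h
    rw [hf.volume_chart hy] at h
    exact (eq_div_iff h0).2 h.symm

theorem continuousOn_conormal (x : M) :
    ContinuousOn (conormal Ω f ξ) (chartAt (Rn n) x).source := by
  refine ((hf.contDiffOn_conormal hθ x).continuousOn.comp (chartAt (Rn n) x).continuousOn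
    (chartAt (Rn n) x).mapsTo).congr fun p hp => ?_
  simp [(chartAt (Rn n) x).left_inv hp]

theorem differentiableAt_coneMap (J : (Rn (n + 1) →L[ℝ] ℝ) ≃L[ℝ] (Rn n × ℝ)) (x : M)
    {z : Rn n × ℝ} (hz : z.1 ∈ (chartAt (Rn n) x).target) :
    DifferentiableAt ℝ (coneMap J (conormal Ω f ξ) (chartAt (Rn n) x)) z := by
  have h : DifferentiableAt ℝ (conormal Ω f ξ ∘ (chartAt (Rn n) x).symm) z.1 :=
    ((hf.contDiffOn_conormal hθ x).contDiffAt
      ((chartAt (Rn n) x).open_target.mem_nhds hz)).differentiableAt (by simp)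
  exact J.differentiableAt.comp z (differentiableAt_snd.fun_smul (h.comp z differentiableAt_fst))

theorem abs_detVol_affForm {x : M} {y : Rn n} (hy : y ∈ (chartAt (Rn n) x).target) :
    |detVol θ ((chartAt (Rn n) x).symm y) (affForm Ω f ξ ((chartAt (Rn n) x).symm y))| *
      volDensity Ω f ξ x y ^ 2 =
    |(Matrix.of fun i j => conormal Ω f ξ ((chartAt (Rn n) x).symm y)
      (fderiv ℝ (fderiv ℝ (f ∘ (chartAt (Rn n) x).symm)) y
        (EuclideanSpace.basisFun (Fin n) ℝ i) (EuclideanSpace.basisFun (Fin n) ℝ j))).det| := by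
  have hp := (chartAt (Rn n) x).map_target hy
  let A : TangentSpace (𝓡 n) ((chartAt (Rn n) x).symm y) →ₗ[ℝ] Rn n :=
    (mfderiv (𝓡 n) (𝓡 n) (chartAt (Rn n) x) ((chartAt (Rn n) x).symm y)).toLinearMap
  have hA : ∀ w : Rn n, A (mfderiv (𝓡 n) (𝓡 n) (chartAt (Rn n) x).symm y w) = w := fun w =>
    mfderiv_chart_symm_apply hy w
  have hα : ∀ v v', affForm Ω f ξ ((chartAt (Rn n) x).symm y) v v' =
      conormal Ω f ξ ((chartAt (Rn n) x).symm y)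
        (fderiv ℝ (fderiv ℝ (f ∘ (chartAt (Rn n) x).symm)) y (A v) (A v')) := fun v v' => by
    have h := hf.affForm_eq_chart hθ hp v v'
    rw [(chartAt (Rn n) x).right_inv hy] at h
    exact h
  -- Bilinearity of the fundamental form, not visible from its definition by extensions, is read off
  -- from the Hessian formula.
  let b : LinearMap.BilinForm ℝ (TangentSpace (𝓡 n) ((chartAt (Rn n) x).symm y)) :=
    LinearMap.mk₂ ℝ (affForm Ω f ξ ((chartAt (Rn n) x).symm y))
      (fun u v w => by rw [hα, hα, hα, map_add, map_add, add_apply, map_add])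
      (fun c u v => by rw [hα, hα, map_smul, map_smul, smul_apply, map_smul])
      (fun u v w => by rw [hα, hα, hα, map_add, map_add, map_add])
      (fun c u v => by rw [hα, hα, map_smul, map_smul, map_smul])
  have h := detVol_mul_sq θ (hθ _) b (fun i => mfderiv (𝓡 n) (𝓡 n) (chartAt (Rn n) x).symm y
    (EuclideanSpace.basisFun (Fin n) ℝ i : Rn n))
  rw [hf.volume_chart hy] at h
  have hM : (Matrix.of fun i j => b
      (mfderiv (𝓡 n) (𝓡 n) (chartAt (Rn n) x).symm y
        (EuclideanSpace.basisFun (Fin n) ℝ i : Rn n))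
      (mfderiv (𝓡 n) (𝓡 n) (chartAt (Rn n) x).symm y
        (EuclideanSpace.basisFun (Fin n) ℝ j : Rn n))) =
      Matrix.of fun i j => conormal Ω f ξ ((chartAt (Rn n) x).symm y)
        (fderiv ℝ (fderiv ℝ (f ∘ (chartAt (Rn n) x).symm)) y
          (EuclideanSpace.basisFun (Fin n) ℝ i) (EuclideanSpace.basisFun (Fin n) ℝ j)) := by
    ext i j
    exact (hα _ _).trans (by rw [hA, hA]; rfl)
  rw [volDensity, sq_abs, ← hM, ← h, abs_mul, abs_sq]
  rfl

/-- The Hessian determinant carries the square of the density and the frame carries one power, so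
one power remains: the Jacobian is |G| times the density of |θ|. -/
theorem abs_det_fderiv_coneMap {Q : (Rn (n + 1) →L[ℝ] ℝ) ≃L[ℝ] Rn (n + 1)}
    (hQ : ∀ v : Fin (n + 1) → Rn (n + 1),
      |(Matrix.of fun i j => Q.symm (EuclideanSpace.basisFun (Fin (n + 1)) ℝ i) (v j)).det| =
        |Ω v|) {x : M} {y : Rn n} (hy : y ∈ (chartAt (Rn n) x).target) (t : ℝ) :
    |(fderiv ℝ (coneMap (Q.trans (prodCoords n)) (conormal Ω f ξ) (chartAt (Rn n) x)) (y, t)).det| =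
      |t| ^ n * (|detVol θ ((chartAt (Rn n) x).symm y)
        (affForm Ω f ξ ((chartAt (Rn n) x).symm y))| * volDensity Ω f ξ x y) := by
  have hopen := (chartAt (Rn n) x).open_target.mem_nhds hy
  have hu : DifferentiableAt ℝ (fderiv ℝ (f ∘ (chartAt (Rn n) x).symm)) y :=
    (((contDiffOn_comp_symm hf.smooth x).contDiffAt hopen).fderiv_right (m := 1)
      (by norm_cast)).differentiableAt one_ne_zero
  have hη : DifferentiableAt ℝ (conormal Ω f ξ ∘ (chartAt (Rn n) x).symm) y :=
    ((hf.contDiffOn_conormal hθ x).contDiffAt hopen).differentiableAt (by simp)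
  have h := abs_det_fderiv_cone hQ hu hη (w := ξ ((chartAt (Rn n) x).symm y)) (by
    filter_upwards [hopen] with y' hy' w
    rw [← dmap_mfderiv_symm hf.smooth hy']
    exact hf.conormal_dmap hθ _ _) (hf.conormal_field hθ _) t
  have h2 := hf.abs_detVol_affForm hθ hy
  have hpos := hf.volDensity_pos hθ hy
  refine mul_right_cancel₀ hpos.ne' (h.trans ?_)
  simp only [Function.comp_apply]
  rw [← h2]
  ring

end IsEquiaffineImmersion

end Charts

/-! ### The measure |θ| through a partition into chart pieces -/

section VolMeasure

open Set Filter

variable {n : ℕ} {M : Type*} [TopologicalSpace M] [ChartedSpace (Rn n) M] [IsManifold (𝓡 n) ∞ M]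
  [MeasurableSpace M] [BorelSpace M]
  {Ω : VolumeForm n} {θ : ∀ p : M, TangentSpace (𝓡 n) p [⋀^Fin n]→ₗ[ℝ] ℝ}
  {cov : CovariantDerivative (𝓡 n) (Rn n) (TangentSpace (𝓡 n) : M → Type _)}
  {f ξ : M → Rn (n + 1)}

omit [IsManifold (𝓡 n) ∞ M] in
theorem measurableSet_target_inter (x : M) {A : Set M} (hA : MeasurableSet A) :
    MeasurableSet ((chartAt (Rn n) x).target ∩ (chartAt (Rn n) x).symm ⁻¹' A) :=
  (chartAt (Rn n) x).continuousOn_symm.measurableSet_inter_preimage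
    (chartAt (Rn n) x).open_target.measurableSet hA

namespace IsEquiaffineImmersion

variable (hf : IsEquiaffineImmersion Ω cov θ f ξ)
include hf

/-- On its target the inverse chart is a measurable embedding, and the density is finite, so `g`
need not be measurable. Measurability of the fibre sums is thus never an issue. -/
theorem lintegral_chartMeasure (x : M) (g : M → ENNReal) :
    ∫⁻ p, g p ∂(chartMeasure θ x) = ∫⁻ y in (chartAt (Rn n) x).target,
      ENNReal.ofReal (volDensity Ω f ξ x y) * g ((chartAt (Rn n) x).symm y) := by
  set e := chartAt (Rn n) x with he
  have hT : MeasurableSet e.target := e.open_target.measurableSet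
  have hρ : AEMeasurable (fun y => ENNReal.ofReal (volDensity Ω f ξ x y))
      (MeasureSpace.volume.restrict e.target) :=
    ((hf.continuousOn_volDensity x).aemeasurable hT).ennreal_ofReal
  set ν : Measure (Rn n) := (MeasureSpace.volume.restrict e.target).withDensity
    (fun y => ENNReal.ofReal (volDensity Ω f ξ x y)) with hν
  have hcm : chartMeasure θ x = ν.map e.symm := by
    rw [chartMeasure, hν]
    congr 1
    refine withDensity_congr_ae ?_
    filter_upwards [ae_restrict_mem hT] with y hy
    rw [hf.volume_chart hy, volDensity]
  have hνT : ν.restrict e.target = ν := by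
    rw [hν, restrict_withDensity hT, Measure.restrict_restrict hT, inter_self]
  have hmap : (Measure.comap (Subtype.val : e.target → Rn n) ν).map Subtype.val = ν := by
    rw [map_comap_subtype_coe hT, hνT]
  have hemb : MeasurableEmbedding (e.target.domRestrict e.symm) :=
    e.symm.isOpenEmbedding_restrict.measurableEmbedding
  have hae : AEMeasurable e.symm ν :=
    (e.continuousOn_symm.aemeasurable hT).mono_ac (withDensity_absolutelyContinuous _ _)
  have hmap2 : ν.map e.symm =
      (Measure.comap (Subtype.val : e.target → Rn n) ν).map (e.target.domRestrict e.symm) := by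
    conv_lhs => rw [← hmap]
    rw [AEMeasurable.map_map_of_aemeasurable (by rw [hmap]; exact hae)
      measurable_subtype_coe.aemeasurable]
    rfl
  calc ∫⁻ p, g p ∂(chartMeasure θ x)
      = ∫⁻ y : e.target, g (e.symm y) ∂(Measure.comap (Subtype.val : e.target → Rn n) ν) := by
        rw [hcm, hmap2, hemb.lintegral_map]
        rfl
    _ = ∫⁻ y, g (e.symm y) ∂ν := by
        conv_rhs => rw [← hmap]
        rw [(MeasurableEmbedding.subtype_coe hT).lintegral_map]
    _ = _ := by
        rw [hν, lintegral_withDensity_eq_lintegral_mul_non_measurable₀ _ hρ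
          (Eventually.of_forall fun y => ENNReal.ofReal_lt_top)]
        rfl

theorem setLIntegral_chartMeasure (x : M) {A : Set M} (hA : MeasurableSet A) (g : M → ENNReal) :
    ∫⁻ p in A, g p ∂(chartMeasure θ x) =
      ∫⁻ y in (chartAt (Rn n) x).target ∩ (chartAt (Rn n) x).symm ⁻¹' A,
        ENNReal.ofReal (volDensity Ω f ξ x y) * g ((chartAt (Rn n) x).symm y) := by
  have hT := (chartAt (Rn n) x).open_target.measurableSet
  rw [← lintegral_indicator hA, hf.lintegral_chartMeasure, ← lintegral_indicator hT,
    ← lintegral_indicator (measurableSet_target_inter x hA)]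
  congr 1
  ext y
  by_cases hy : y ∈ (chartAt (Rn n) x).target <;>
  by_cases hyA : (chartAt (Rn n) x).symm y ∈ A <;> simp [indicator, hy, hyA]

theorem chartMeasure_apply (x : M) {A : Set M} (hA : MeasurableSet A) :
    chartMeasure θ x A = ∫⁻ y in (chartAt (Rn n) x).target ∩ (chartAt (Rn n) x).symm ⁻¹' A,
      ENNReal.ofReal (volDensity Ω f ξ x y) := by
  have h := hf.setLIntegral_chartMeasure x hA (fun _ => 1)
  simpa using h

omit [MeasurableSpace M] [BorelSpace M] in
/-- Transformation of the volume density under a change of charts. -/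
theorem volDensity_eq_det_mul {x x' : M} {y : Rn n} (hy : y ∈ (chartAt (Rn n) x).target)
    (hy' : (chartAt (Rn n) x).symm y ∈ (chartAt (Rn n) x').source) :
    DifferentiableAt ℝ (chartAt (Rn n) x' ∘ (chartAt (Rn n) x).symm) y ∧
    volDensity Ω f ξ x y =
      |(fderiv ℝ (chartAt (Rn n) x' ∘ (chartAt (Rn n) x).symm) y).det| *
        volDensity Ω f ξ x' ((chartAt (Rn n) x' ∘ (chartAt (Rn n) x).symm) y) := by
  set e := chartAt (Rn n) x with he
  set e' := chartAt (Rn n) x' with he'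
  set τ : Rn n → Rn n := e' ∘ e.symm with hτ
  have hτd : DifferentiableAt ℝ τ y := by
    rw [← mdifferentiableAt_iff_differentiableAt]
    exact MDifferentiableAt.comp y (I' := 𝓡 n)
      (mdifferentiableAt_atlas (chart_mem_atlas (Rn n) x') hy')
      (mdifferentiableAt_atlas_symm (chart_mem_atlas (Rn n) x) hy)
  refine ⟨hτd, ?_⟩
  have hτy : τ y ∈ e'.target := e'.map_source hy'
  have hu' : DifferentiableAt ℝ (f ∘ e'.symm) (τ y) :=
    ((contDiffOn_comp_symm hf.smooth x').contDiffAt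
      (e'.open_target.mem_nhds hτy)).differentiableAt (by simp)
  have hev : (f ∘ e.symm) =ᶠ[𝓝 y] (f ∘ e'.symm) ∘ τ := by
    have : ∀ᶠ y' in 𝓝 y, e.symm y' ∈ e'.source :=
      (e.continuousAt_symm hy).eventually (e'.open_source.mem_nhds hy')
    filter_upwards [this] with y' hy''
    simp [hτ, e'.left_inv hy'']
  have hder : fderiv ℝ (f ∘ e.symm) y = (fderiv ℝ (f ∘ e'.symm) (τ y)).comp (fderiv ℝ τ y) := by
    rw [hev.fderiv_eq, fderiv_comp y hu' hτd]
  have hξ : ξ (e'.symm (τ y)) = ξ (e.symm y) := by simp [hτ, e'.left_inv hy']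
  have h := volume_snoc_comp Ω (fderiv ℝ (f ∘ e'.symm) (τ y)).toLinearMap
    (fderiv ℝ τ y).toLinearMap (ξ (e.symm y))
  simp only [volDensity, ← he, ← he', hder, hξ]
  exact (congrArg abs h).trans (abs_mul _ _)

/-- The chart at `x` sees all of `A`, the one at `x'` perhaps only a part; on the overlap they agree
by change of variables. -/
theorem chartMeasure_le (x x' : M) {A : Set M} (hA : MeasurableSet A)
    (hAs : A ⊆ (chartAt (Rn n) x).source) : chartMeasure θ x' A ≤ chartMeasure θ x A := by
  rw [hf.chartMeasure_apply x' hA, hf.chartMeasure_apply x hA]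
  set e := chartAt (Rn n) x with he
  set e' := chartAt (Rn n) x' with he'
  set τ : Rn n → Rn n := e' ∘ e.symm with hτ
  set D := e.target ∩ e.symm ⁻¹' (A ∩ e'.source) with hD
  have hDm : MeasurableSet D :=
    measurableSet_target_inter x (hA.inter e'.open_source.measurableSet)
  have himg : e'.target ∩ e'.symm ⁻¹' A = τ '' D := by
    ext y'
    constructor
    · rintro ⟨hy', hyA⟩
      have hs := hAs hyA
      refine ⟨e (e'.symm y'), ⟨e.map_source hs, ?_⟩, ?_⟩
      · simp only [mem_preimage, e.left_inv hs]
        exact ⟨hyA, e'.map_target hy'⟩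
      · simp [hτ, e.left_inv hs, e'.right_inv hy']
    · rintro ⟨y, ⟨hy, hyA, hys⟩, rfl⟩
      refine ⟨e'.map_source hys, ?_⟩
      simpa [hτ, e'.left_inv hys] using hyA
  have hinj : InjOn τ D := fun y hy z hz h =>
    e.symm.injOn hy.1 hz.1 (e'.injOn hy.2.2 hz.2.2 h)
  rw [himg, lintegral_image_eq_lintegral_abs_det_fderiv_mul MeasureSpace.volume hDm
    (fun y hy => (hf.volDensity_eq_det_mul (x' := x') hy.1 hy.2.2).1.hasFDerivAt.hasFDerivWithinAt)
    hinj]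
  refine le_trans (le_of_eq (setLIntegral_congr_fun hDm fun y hy => ?_))
    (lintegral_mono_set (t := e.target ∩ e.symm ⁻¹' A) fun y hy => ⟨hy.1, hy.2.1⟩)
  rw [(hf.volDensity_eq_det_mul (x' := x') hy.1 hy.2.2).2, ENNReal.ofReal_mul (abs_nonneg _)]

/-- On `A i` the chart measure at `x i` dominates all others, so it is the supremum there. -/
theorem volMeasure_eq_sum {ι : Type*} [Fintype ι] (x : ι → M) (A : ι → Set M)
    (hA : ∀ i, MeasurableSet (A i)) (hAd : Pairwise (Function.onFun Disjoint A))
    (hAs : ∀ i, A i ⊆ (chartAt (Rn n) (x i)).source) (hAc : ⋃ i, A i = univ) :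
    volMeasure θ = Measure.sum fun i => (chartMeasure θ (x i)).restrict (A i) := by
  have hdec : ∀ (μ : Measure M), μ = Measure.sum fun i => μ.restrict (A i) := fun μ => by
    rw [← Measure.restrict_iUnion hAd hA, hAc, Measure.restrict_univ]
  have hmono : ∀ μ ν : ι → Measure M, (∀ i, μ i ≤ ν i) → Measure.sum μ ≤ Measure.sum ν :=
    fun μ ν h => Measure.le_iff.2 fun s hs => by
      rw [Measure.sum_apply _ hs, Measure.sum_apply _ hs]
      exact ENNReal.tsum_le_tsum fun i => h i s
  refine le_antisymm (iSup_le fun x' => ?_) ?_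
  · rw [hdec (chartMeasure θ x')]
    refine hmono _ _ fun i => Measure.le_iff.2 fun s hs => ?_
    rw [Measure.restrict_apply hs, Measure.restrict_apply hs]
    exact hf.chartMeasure_le _ _ (hs.inter (hA i)) (inter_subset_right.trans (hAs i))
  · rw [hdec (volMeasure θ)]
    exact hmono _ _ fun i =>
      Measure.restrict_mono le_rfl (le_iSup (fun x => chartMeasure θ x) (x i))

end IsEquiaffineImmersion

omit [IsManifold (𝓡 n) ∞ M] in
theorem exists_disjoint_chart_cover [CompactSpace M] :
    ∃ (m : ℕ) (x : Fin m → M) (A : Fin m → Set M), (∀ i, MeasurableSet (A i)) ∧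
      Pairwise (Function.onFun Disjoint A) ∧ (∀ i, A i ⊆ (chartAt (Rn n) (x i)).source) ∧
      ⋃ i, A i = univ := by
  obtain ⟨t, ht⟩ := isCompact_univ.elim_finite_subcover
    (fun x : M => (chartAt (Rn n) x).source) (fun x => (chartAt (Rn n) x).open_source)
    fun p _ => mem_iUnion.2 ⟨p, mem_chart_source (Rn n) p⟩
  let x : Fin t.card → M := fun i => t.equivFin.symm i
  refine ⟨t.card, x, disjointed fun i => (chartAt (Rn n) (x i)).source, fun i => ?_,
    disjoint_disjointed _, fun i => disjointed_subset _ i, ?_⟩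
  · exact disjointedRec (fun s j hs => hs.diff (chartAt (Rn n) (x j)).open_source.measurableSet)
      (chartAt (Rn n) (x i)).open_source.measurableSet
  · rw [iUnion_disjointed]
    refine eq_univ_of_forall fun p => ?_
    obtain ⟨q, hq, hpq⟩ := mem_iUnion₂.1 (ht (mem_univ p))
    refine mem_iUnion.2 ⟨t.equivFin ⟨q, hq⟩, ?_⟩
    simpa [x] using hpq

end VolMeasure

/-! ### From the ellipsoid bundle to the solid cone -/

section Total

open Set Filter

theorem setLIntegral_coneDomain {V M Y : Type*} [NormedAddCommGroup V] [NormedSpace ℝ V]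
    [TopologicalSpace M] [MeasurableSpace M] [BorelSpace M] [NormedAddCommGroup Y]
    [NormedSpace ℝ Y] [FiniteDimensional ℝ Y] [MeasurableSpace Y] [BorelSpace Y]
    {lam : M → V →L[ℝ] ℝ} {e : OpenPartialHomeomorph M Y} {A : Set M} {G : Set (V →L[ℝ] ℝ)}
    (hlam : ContinuousOn lam e.source) (hA : MeasurableSet A) (hG : IsOpen G) (ν : Measure Y)
    [SFinite ν] {F : Y × ℝ → ENNReal} (hF : Measurable F) :
    ∫⁻ z in coneDomain lam e A G, F z ∂(ν.prod volume) =
      ∫⁻ y in e.target ∩ e.symm ⁻¹' A, (∫⁻ t in {t : ℝ | t • lam (e.symm y) ∈ G}, F (y, t)) ∂ν := by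
  have hD := measurableSet_coneDomain hlam hA hG
  have hTA : MeasurableSet (e.target ∩ e.symm ⁻¹' A) :=
    e.continuousOn_symm.measurableSet_inter_preimage e.open_target.measurableSet hA
  rw [← lintegral_indicator hD, lintegral_prod _ (hF.indicator hD).aemeasurable,
    ← lintegral_indicator hTA]
  congr 1
  ext y
  by_cases hy : y ∈ e.target ∩ e.symm ⁻¹' A
  · rw [indicator_of_mem hy]
    have hS : MeasurableSet {t : ℝ | t • lam (e.symm y) ∈ G} :=
      (hG.preimage (continuous_id.smul continuous_const)).measurableSet
    rw [← lintegral_indicator hS]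
    congr 1
    ext t
    by_cases ht : t • lam (e.symm y) ∈ G
    · rw [indicator_of_mem (show t ∈ {t : ℝ | t • lam (e.symm y) ∈ G} from ht),
        indicator_of_mem (show (y, t) ∈ coneDomain lam e A G from ⟨hy.1, hy.2, ht⟩)]
    · rw [indicator_of_notMem (show t ∉ {t : ℝ | t • lam (e.symm y) ∈ G} from ht),
        indicator_of_notMem (show (y, t) ∉ coneDomain lam e A G from fun h => ht h.2.2)]
  · rw [indicator_of_notMem hy]
    have : ∀ t, (coneDomain lam e A G).indicator F (y, t) = 0 := fun t =>
      indicator_of_notMem (fun h => hy ⟨h.1, h.2.1⟩) _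
    simp [this]

variable {n : ℕ} {M : Type*} [TopologicalSpace M] [ChartedSpace (Rn n) M] [IsManifold (𝓡 n) ∞ M]
  {Ω : VolumeForm n} {θ : ∀ p : M, TangentSpace (𝓡 n) p [⋀^Fin n]→ₗ[ℝ] ℝ}
  {cov : CovariantDerivative (𝓡 n) (Rn n) (TangentSpace (𝓡 n) : M → Type _)}
  {f ξ : M → Rn (n + 1)} {S : Set (Ext n)}
  {Q : (Rn (n + 1) →L[ℝ] ℝ) ≃L[ℝ] Rn (n + 1)}

namespace IsEquiaffineImmersion

variable (hf : IsEquiaffineImmersion Ω cov θ f ξ) (hθ : ∀ p, θ p ≠ 0)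
  (hS : ∀ φ, φ ∈ S ↔ ‖Q (heightDual Ω φ)‖ = 1)
include hf hθ hS

/-- The sum over the fibre of the ellipsoid bundle as an integral over a segment. -/
theorem tsum_fibre (p : M) :
    ∑' t : {t : ℝ // (p, t) ∈ ellipsoidBundle θ f S},
      ENNReal.ofReal (|lipschitzKilling Ω θ f ξ (p, t)| * |(t : ℝ)|) =
    ((n : ENNReal) + 1) * ∫⁻ t in {t : ℝ | t • conormal Ω f ξ p ∈ {l | ‖Q l‖ < 1}},
      ENNReal.ofReal (|t| ^ n * |detVol θ p (affForm Ω f ξ p)|) := by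
  set d := |detVol θ p (affForm Ω f ξ p)| with hd
  set c := ‖Q (conormal Ω f ξ p)‖ with hc
  have hc0 : 0 < c := by
    refine norm_pos_iff.2 fun h => ?_
    have h0 : conormal Ω f ξ p = 0 := by simpa using h
    have := hf.conormal_field hθ p
    simp [h0] at this
  have hr : 0 < c⁻¹ := inv_pos.2 hc0
  -- The fibre is given by |t| ‖Q λ(p)‖ = 1, so it bounds the segment on which t λ(p) lies in the
  -- unit ball.
  have hfib : {t : ℝ | (p, t) ∈ ellipsoidBundle θ f S} = (({c⁻¹, -c⁻¹} : Finset ℝ) : Set ℝ) := by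
    ext t
    change nuTilde θ f p t ∈ S ↔ _
    rw [hS, hf.heightDual_nuTilde hθ, map_smul, norm_smul, Real.norm_eq_abs, ← hc,
      ← eq_div_iff hc0.ne', one_div, abs_eq hr.le]
    simp
  have hball : {t : ℝ | t • conormal Ω f ξ p ∈ {l | ‖Q l‖ < 1}} = {t : ℝ | |t| < c⁻¹} := by
    ext t
    change ‖Q (t • conormal Ω f ξ p)‖ < 1 ↔ |t| < c⁻¹
    rw [map_smul, norm_smul, Real.norm_eq_abs, ← hc, ← lt_div_iff₀ hc0, one_div]
  have hsum : ∑' t : {t : ℝ // (p, t) ∈ ellipsoidBundle θ f S},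
      ENNReal.ofReal (|lipschitzKilling Ω θ f ξ (p, t)| * |(t : ℝ)|) =
      ∑ t ∈ ({c⁻¹, -c⁻¹} : Finset ℝ), ENNReal.ofReal (|t| ^ n * d * |t|) := by
    rw [← Finset.tsum_subtype']
    have h : ∀ t : ℝ, |lipschitzKilling Ω θ f ξ (p, t)| = |t| ^ n * d :=
      fun t => hf.abs_lipschitzKilling hθ p t
    simp only [h]
    change ∑' t : ↥{t : ℝ | (p, t) ∈ ellipsoidBundle θ f S},
      ENNReal.ofReal (|(t : ℝ)| ^ n * d * |(t : ℝ)|) = _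
    rw [hfib]
  have hne : c⁻¹ ≠ -c⁻¹ := by linarith
  rw [hsum, Finset.sum_pair hne, hball, abs_neg, abs_of_pos hr,
    ← ENNReal.ofReal_add (by positivity) (by positivity)]
  have hmul : ∀ t : ℝ, ENNReal.ofReal (|t| ^ n * d) =
      ENNReal.ofReal (|t| ^ n) * ENNReal.ofReal d := fun t => ENNReal.ofReal_mul (by positivity)
  simp only [hmul]
  rw [lintegral_mul_const _ (by fun_prop), ← mul_assoc, lintegral_ball_abs_pow n hr.le,
    ← ENNReal.ofReal_mul (by positivity)]
  congr 1
  ring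

/-- After `tsum_fibre` the integrand times the density of |θ| is the Jacobian of the cone map, and
Tonelli assembles the segments into the cone domain. -/
theorem setLIntegral_tsum_fibre [MeasurableSpace M] [BorelSpace M]
    (hQ : ∀ v : Fin (n + 1) → Rn (n + 1),
      |(Matrix.of fun i j => Q.symm (EuclideanSpace.basisFun (Fin (n + 1)) ℝ i) (v j)).det| =
        |Ω v|) (x : M) {A : Set M} (hA : MeasurableSet A) :
    ∫⁻ p in A, (∑' t : {t : ℝ // (p, t) ∈ ellipsoidBundle θ f S},
      ENNReal.ofReal (|lipschitzKilling Ω θ f ξ (p, t)| * |(t : ℝ)|)) ∂(chartMeasure θ x) =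
    ((n : ENNReal) + 1) * ∫⁻ z in coneDomain (conormal Ω f ξ) (chartAt (Rn n) x) A
        {l | ‖Q l‖ < 1},
      ENNReal.ofReal |(fderiv ℝ (coneMap (Q.trans (prodCoords n)) (conormal Ω f ξ)
        (chartAt (Rn n) x)) z).det|
        ∂((MeasureSpace.volume : Measure (Rn n)).prod (MeasureSpace.volume : Measure ℝ)) := by
  have hG : IsOpen {l : Rn (n + 1) →L[ℝ] ℝ | ‖Q l‖ < 1} :=
    isOpen_lt Q.continuous.norm continuous_const
  have hF : Measurable fun z : Rn n × ℝ => ENNReal.ofReal |(fderiv ℝ (coneMap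
      (Q.trans (prodCoords n)) (conormal Ω f ξ) (chartAt (Rn n) x)) z).det| :=
    (ContinuousLinearMap.continuous_det.measurable.comp (measurable_fderiv ℝ _)).abs.ennreal_ofReal
  rw [hf.setLIntegral_chartMeasure x hA,
    setLIntegral_coneDomain (hf.continuousOn_conormal hθ x) hA hG _ hF,
    ← lintegral_const_mul' _ _ (by simp)]
  refine setLIntegral_congr_fun (measurableSet_target_inter (n := n) x hA) fun y hy => ?_
  have hpos := (hf.volDensity_pos hθ hy.1).le
  simp only [hf.tsum_fibre hθ hS]
  rw [mul_left_comm, ← lintegral_const_mul' _ _ ENNReal.ofReal_ne_top]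
  congr 2
  ext t
  rw [hf.abs_det_fderiv_coneMap hθ hQ hy.1, ← ENNReal.ofReal_mul hpos]
  congr 1
  ring

end IsEquiaffineImmersion

end Total

end Equiaffine

end

/-! ### The total absolute curvature of a convex hypersurface -/

theorem theorem3p5 (n : ℕ) (M : Type*) [TopologicalSpace M] [T2Space M] [CompactSpace M]
    [ChartedSpace (Equiaffine.Rn n) M] [IsManifold (𝓡 n) ∞ M]
    [MeasurableSpace M] [BorelSpace M]
    (cov : CovariantDerivative (𝓡 n) (Equiaffine.Rn n) (TangentSpace (𝓡 n) : M → Type _))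
    (θ : ∀ p : M, TangentSpace (𝓡 n) p [⋀^Fin n]→ₗ[ℝ] ℝ)
    (hM : Equiaffine.IsEquiaffineStructure cov θ)
    (Ω : Equiaffine.VolumeForm n) (hΩ : Ω ≠ 0)
    (f ξ : M → Equiaffine.Rn (n + 1))
    (hf : Equiaffine.IsEquiaffineImmersion Ω cov θ f ξ)
    (S : Set (Equiaffine.Ext n)) (hS : Equiaffine.IsUnitEllipsoid Ω S)
    (hconv : Equiaffine.IsConvexHypersurface f) :
    Equiaffine.totalAbsCurv Ω θ f ξ S = 2 := by
  obtain ⟨hemb, K, hK, hc, hi, hr⟩ := hconv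
  obtain ⟨Q, hQS, hQ⟩ := hS.exists_coords hΩ
  obtain ⟨m, x, A, hA, hAd, hAs, hAc⟩ := Equiaffine.exists_disjoint_chart_cover (n := n) (M := M)
  have hθ := hM.vol_ne_zero
  have hG : IsOpen {l : Equiaffine.Rn (n + 1) →L[ℝ] ℝ | ‖Q l‖ < 1} :=
    isOpen_lt Q.continuous.norm continuous_const
  have hcore := Equiaffine.sum_lintegral_coneDomain hK hc hi hr hemb
    hf.smooth_field.continuous (fun l p hp => hf.eq_smul_of_isMaxAt hθ hp) (hf.conormal_field hθ)
    (e := fun i => chartAt (Equiaffine.Rn n) (x i)) (fun i => hf.continuousOn_conormal hθ (x i))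
    hA hAd hAs hAc hG (J := Q.trans (Equiaffine.prodCoords n))
    (fun i z hz => hf.differentiableAt_coneMap hθ _ (x i) hz) volume
  have himg : (Q.trans (Equiaffine.prodCoords n)) '' {l | ‖Q l‖ < 1} =
      Equiaffine.prodCoords n '' Metric.ball 0 1 := by
    ext z
    constructor
    · rintro ⟨l, hl, rfl⟩
      exact ⟨Q l, by simpa using hl, rfl⟩
    · rintro ⟨w, hw, rfl⟩
      exact ⟨Q.symm w, by simpa using hw, by simp⟩
  have hball0 : volume (Metric.ball (0 : Equiaffine.Rn (n + 1)) 1) ≠ 0 :=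
    (Metric.measure_ball_pos volume 0 one_pos).ne'
  have hballt : volume (Metric.ball (0 : Equiaffine.Rn (n + 1)) 1) ≠ ⊤ := measure_ball_lt_top.ne
  -- The numerator becomes (n + 1) · 2 vol(ball), and the sphere in the denominator has measure (n +
  -- 1) vol(ball).
  rw [Equiaffine.totalAbsCurv, hf.volMeasure_eq_sum x A hA hAd hAs hAc, lintegral_sum_measure,
    tsum_fintype, Finset.sum_congr rfl fun i _ => hf.setLIntegral_tsum_fibre hθ hQS hQ (x i) (hA i),
    ← Finset.mul_sum, hcore, himg, Equiaffine.volume_prodCoords_image,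
    Measure.toSphere_apply_univ, finrank_euclideanSpace_fin, ← mul_assoc, mul_comm _ 2, mul_assoc]
  push_cast
  refine ENNReal.mul_div_cancel_right ?_ ?_
  · exact mul_ne_zero (by simp) hball0
  · exact ENNReal.mul_ne_top (by simp) hballt
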